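/- Let $\Bbbk$ be a field and $n\ge 0$. For $0\le k\le n$ let $[k]=\{1,\dots,k\}$ (so $[0]=\varnothing$). Let $\mathrm{SEO}_n$ be the category with objects $[0],\dots,[n]$ whose morphisms are the order-preserving surjective functions, and let $\mathrm{PO}_n$ be the monoid of all order-preserving partial functions on $[n]$ (partial functions $f$ such that $x\le y$ implies $f(x)\le f(y)$ for all $x,y$ in the domain of $f$) under composition. Let $\Bbbk\mathrm{SEO}_n$ be the category algebra (with basis the morphisms, $g\cdot f$ being the composite $gf$ if it is defined and $0$ otherwise) and $\Bbbk\mathrm{PO}_n$ the monoid algebra. Let $Q$ be the quiver with vertices $[0],\dots,[n]$ and, for $1\le k\le n-1$, with $k$ arrows $d_1^k,\dots,d_k^k$ from $[k+1]$ to $[k]$, and no other arrows. Regard $Q$ as a subgraph of $\mathrm{SEO}_n$: $d_i^k$ is the unique order-preserving surjection $f:[k+1]\to[k]$ with $f(i)=f(i+1)$. Let $R$ be the set of relations $$d_i^{k-1}d_j^k=d_{j-1}^{k-1}d_i^k\qquad(2\le k\le n-1,\ 1\le i<j\le k).$$ Then $(Q,R)$ is a quiver presentation of $\Bbbk\mathrm{SEO}_n$,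 and $\Bbbk\mathrm{PO}_n$ is Morita equivalent to $\Bbbk\mathrm{SEO}_n$, so that $(Q,R)$ is also a quiver presentation of $\Bbbk\mathrm{PO}_n$. Here a pair $(Q,R)$ is a quiver presentation of a split basic algebra $A$ (a finite-dimensional algebra with $A/\operatorname{Rad}A\cong\Bbbk^m$ for some $m$) if the following two conditions hold. First, $Q$ is the ordinary quiver of $A$: its vertices correspond to a complete set $\{e_a\}$ of primitive orthogonal idempotents, and its arrows from $a$ to $b$ correspond to elements of $e_b(\operatorname{Rad}A)e_a$ whose classes form a basis of $(e_b+\operatorname{Rad}^2A)(\operatorname{Rad}A/\operatorname{Rad}^2A)(e_a+\operatorname{Rad}^2A)$. Secondly, let $\mathscr L(A)$ be the $\Bbbk$-linear category whose objects are the vertices and whose hom-spaces are $\mathscr L(A)(a,b)=e_bAe_a$; then the functor from the free $\Bbbk$-linear category on $Q$ to $\mathscr L(A)$ determined by these elements induces an isomorphism from the quotient by the smallest $\Bbbk$-linear congruence containing $R$ onto $\mathscr L(A)$. For $A=\Bbbk\mathrm{SEO}_n$ the idempotents are the identities of the objects $[k]$, and the elements corresponding to the arrows are the morphisms $d_i^k$.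 A quiver presentation of a finite-dimensional algebra that is not basic is a quiver presentation of a split basic algebra Morita equivalent to it. -/

import Mathlib

open CategoryTheory

universe u v w

/-! ### Linear category congruences and quotients -/

section LinearQuotient

variable (k : Type u) [Field k] {C : Type v} [Category.{w} C] [Preadditive C] [Linear k C]

/-- The smallest `k`-linear category congruence `ρ_R` containing the relation `R` on the morphisms
of a `k`-linear category: it is an equivalence relation on every hom-set, and it is compatible with
composition, addition and scalar multiplication. -/
inductive LinCongr (R : HomRel C) : HomRel C
  | rel {X Y : C} {f g : X ⟶ Y} (h : R f g) : LinCongr R f g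
  | refl {X Y : C} (f : X ⟶ Y) : LinCongr R f f
  | symm {X Y : C} {f g : X ⟶ Y} (h : LinCongr R f g) : LinCongr R g f
  | trans {X Y : C} {f g h : X ⟶ Y} (h₁ : LinCongr R f g) (h₂ : LinCongr R g h) : LinCongr R f h
  | comp {X Y Z : C} {f f' : X ⟶ Y} {g g' : Y ⟶ Z} (h₁ : LinCongr R f f')
      (h₂ : LinCongr R g g') : LinCongr R (f ≫ g) (f' ≫ g')
  | add {X Y : C} {f f' g g' : X ⟶ Y} (h₁ : LinCongr R f f') (h₂ : LinCongr R g g') :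
      LinCongr R (f + g) (f' + g')
  | smul {X Y : C} (c : k) {f g : X ⟶ Y} (h : LinCongr R f g) : LinCongr R (c • f) (c • g)

instance LinCongr.congruence (R : HomRel C) : Congruence (LinCongr k R) where
  equivalence := ⟨LinCongr.refl, LinCongr.symm, LinCongr.trans⟩
  comp_left f _ _ h := LinCongr.comp (LinCongr.refl f) h
  comp_right g h := LinCongr.comp h (LinCongr.refl g)

/-- The quotient category `L / ρ_R`. -/
abbrev LinQuotient (R : HomRel C) : Type v := CategoryTheory.Quotient (LinCongr k R)

instance LinQuotient.preadditive (R : HomRel C) : Preadditive (LinQuotient k R) :=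
  CategoryTheory.Quotient.preadditive _ fun _ _ _ _ _ _ h₁ h₂ => LinCongr.add h₁ h₂

instance LinQuotient.functor_additive (R : HomRel C) :
    (CategoryTheory.Quotient.functor (LinCongr k R)).Additive :=
  CategoryTheory.Quotient.functor_additive _ fun _ _ _ _ _ _ h₁ h₂ => LinCongr.add h₁ h₂

instance LinQuotient.linear (R : HomRel C) : Linear k (LinQuotient k R) :=
  CategoryTheory.Quotient.linear k _ fun c _ _ _ _ h => LinCongr.smul c h

end LinearQuotient

/-! ### The free linear category on a quiver and presentations of linear categories -/

section Presentation

variable (k : Type u) [Field k]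

/-- The free `k`-linear category `L_k[Q*]` generated by the quiver `V`: its morphisms are the
linear combinations of paths. -/
abbrev FreeLinCat (V : Type) [Quiver.{0} V] : Type := Free k (Paths V)

/-- A relation `R` on the free category `Q*`, regarded as a relation on `L_k[Q*]`. -/
inductive linRel {V : Type} [Quiver.{0} V] (R : HomRel (Paths V)) : HomRel (FreeLinCat k V)
  | of {X Y : Paths V} {p q : X ⟶ Y} (h : R p q) :
    linRel R ((Free.embedding k (Paths V)).map p) ((Free.embedding k (Paths V)).map q)

variable {V : Type} [Quiver.{0} V] {L : Type v} [Category.{w} L] [Preadditive L] [Linear k L]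

/-- The linear extension to linear combinations of paths of a morphism of graphs `φ : V ⥤q L`
(a path is sent to the composite of the images of its arrows). -/
noncomputable def freeLinMap (φ : V ⥤q L) (X Y : Paths V) :
    ((X ⟶ Y) →₀ k) →ₗ[k] ((Paths.lift φ).obj X ⟶ (Paths.lift φ).obj Y) :=
  Finsupp.linearCombination k fun p : X ⟶ Y => (Paths.lift φ).map p

lemma freeLinMap_single (φ : V ⥤q L) {X Y : Paths V} (p : X ⟶ Y) (c : k) :
    freeLinMap k φ X Y (Finsupp.single p c) = c • (Paths.lift φ).map p :=
  Finsupp.linearCombination_single k c p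

lemma freeLinMap_comp (φ : V ⥤q L) {X Y Z : FreeLinCat k V} (f : X ⟶ Y) (g : Y ⟶ Z) :
    freeLinMap k φ X Z (f ≫ g) = freeLinMap k φ X Y f ≫ freeLinMap k φ Y Z g := by
  induction f using Finsupp.induction_linear with
  | zero =>
    have h : (0 : X ⟶ Y) ≫ g = 0 := Limits.zero_comp
    refine (congrArg (freeLinMap k φ X Z) h).trans ?_
    refine (map_zero _).trans ?_
    rw [map_zero, Limits.zero_comp]
  | add a b ha hb =>
    have h : ((a : X ⟶ Y) + (b : X ⟶ Y)) ≫ g = (a : X ⟶ Y) ≫ g + (b : X ⟶ Y) ≫ g :=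
      Preadditive.add_comp _ _ _ _ _ _
    refine (congrArg (freeLinMap k φ X Z) h).trans ?_
    refine (map_add (freeLinMap k φ X Z) _ _).trans ?_
    rw [map_add, Preadditive.add_comp]
    exact congrArg₂ (· + ·) ha hb
  | single p c =>
    induction g using Finsupp.induction_linear with
    | zero =>
      have h : (Finsupp.single p c : X ⟶ Y) ≫ (0 : Y ⟶ Z) = 0 := Limits.comp_zero
      refine (congrArg (freeLinMap k φ X Z) h).trans ?_
      refine (map_zero _).trans ?_
      rw [map_zero, Limits.comp_zero]
    | add a b ha hb =>
      have h := Preadditive.comp_add X Y Z (Finsupp.single p c : X ⟶ Y) a b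
      refine (congrArg (freeLinMap k φ X Z) h).trans ?_
      refine (map_add (freeLinMap k φ X Z) _ _).trans ?_
      rw [map_add, Preadditive.comp_add]
      exact congrArg₂ (· + ·) ha hb
    | single q d =>
      refine (congrArg (freeLinMap k φ X Z)
        (Free.single_comp_single k (Paths V) p q c d)).trans ?_
      refine (freeLinMap_single k φ (p ≫ q) (c * d)).trans ?_
      refine Eq.trans ?_ (congrArg₂ (· ≫ ·) (freeLinMap_single k φ p c).symm
        (freeLinMap_single k φ q d).symm)
      refine (congrArg ((c * d) • ·) ((Paths.lift φ).map_comp p q)).trans ?_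
      simp only [Linear.smul_comp, Linear.comp_smul, smul_smul, mul_comm]

/-- The functor `L_k[Q*] ⥤ L` extending a morphism of graphs `φ : V ⥤q L`. -/
noncomputable def freeLinLift (φ : V ⥤q L) : FreeLinCat k V ⥤ L where
  obj X := φ.obj X
  map {X Y} f := freeLinMap k φ X Y f
  map_id X := (freeLinMap_single k φ (CategoryStruct.id (obj := Paths V) X) 1).trans
    ((one_smul _ _).trans ((Paths.lift φ).map_id X))
  map_comp f g := freeLinMap_comp k φ f g

/-- `(V, R)` is a presentation of the `k`-linear category `L`, where the quiver `V` is regarded as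
a subgraph of `L` through `φ`: the vertices of `V` are all the objects of `L`, the arrows of `V` are
distinct morphisms of `L`, the relation `R` holds in `L`, and the induced functor
`L_k[Q*] / ρ_R ⥤ L` is an isomorphism of `k`-linear categories (it is bijective on objects because
`φ` is). -/
structure IsLinPresentation (φ : V ⥤q L) (R : HomRel (FreeLinCat k V)) : Prop where
  obj_bijective : Function.Bijective φ.obj
  map_injective : ∀ a b : V, Function.Injective fun x : a ⟶ b => φ.map x
  respects : ∀ (X Y : FreeLinCat k V) (f g : X ⟶ Y), LinCongr k R f g →
    (freeLinLift k φ).map f = (freeLinLift k φ).map g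
  additive : (CategoryTheory.Quotient.lift (LinCongr k R) (freeLinLift k φ) respects).Additive
  linear : (CategoryTheory.Quotient.lift (LinCongr k R) (freeLinLift k φ) respects).Linear k
  isEquivalence :
    (CategoryTheory.Quotient.lift (LinCongr k R) (freeLinLift k φ) respects).IsEquivalence

end Presentation

/-! ### Idempotents, the linear category of an algebra, ordinary quivers -/

section Algebra

variable (k : Type u) [Field k] {A : Type v} [Ring A] [Algebra k A]

/-- A primitive idempotent: a nonzero idempotent which is not the sum of two nonzero orthogonal
idempotents. -/
def IsPrimitiveIdempotent (e : A) : Prop :=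
  IsIdempotentElem e ∧ e ≠ 0 ∧
    ∀ f g : A, IsIdempotentElem f → IsIdempotentElem g → f * g = 0 → g * f = 0 → e = f + g →
      f = 0 ∨ g = 0

variable (A) in
/-- `A` is a split basic algebra: it is finite dimensional, and `A / Rad A` is isomorphic to
`k^m` for some `m`. -/
def IsSplitBasic : Prop :=
  FiniteDimensional k A ∧ ∃ m : ℕ, Nonempty ((A ⧸ Ring.jacobson A) ≃ₐ[k] (Fin m → k))

variable (A) in
/-- The (Jacobson) radical `Rad A`, as a subspace of `A`. -/
def rad : Submodule k A := (Ring.jacobson A).restrictScalars k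

variable (A) in
/-- The square `Rad² A` of the radical: the linear span of the products of two elements. -/
def radSq : Submodule k A := rad k A * rad k A

variable {V : Type}

/-- The subspace `e_b A e_a` of all `x` with `e_b x e_a = x`. -/
def cornerSpace (e : V → A) (a b : V) : Submodule k A where
  carrier := {x | e b * x * e a = x}
  add_mem' {x y} hx hy := by
    simp only [Set.mem_ofPred_eq] at hx hy ⊢
    rw [mul_add, add_mul, hx, hy]
  zero_mem' := by simp
  smul_mem' c x hx := by
    simp only [Set.mem_ofPred_eq] at hx ⊢
    rw [mul_smul_comm, smul_mul_assoc, hx]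

variable {k} in
lemma corner_left_mul {e : V → A} (he : ∀ a, IsIdempotentElem (e a)) {a b : V} {x : A}
    (hx : x ∈ cornerSpace k e a b) : e b * x = x := by
  have h : e b * x * e a = x := hx
  rw [← h, ← mul_assoc, ← mul_assoc, (he b).eq]

variable {k} in
lemma corner_mul_right {e : V → A} (he : ∀ a, IsIdempotentElem (e a)) {a b : V} {x : A}
    (hx : x ∈ cornerSpace k e a b) : x * e a = x := by
  have h : e b * x * e a = x := hx
  rw [← h, mul_assoc, (he a).eq]

/-- The `k`-linear category `𝓛(A)` of a family of idempotents `e` of `A`: its objects are the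
indices of the family, the hom-space from `a` to `b` is `e_b A e_a`, and the composition
"first `x`, then `y`" is the product `y * x` in `A`. -/
structure LinCatOf (k : Type u) [Field k] {A : Type v} [Ring A] [Algebra k A] {V : Type}
    {e : V → A} (he : ∀ a, IsIdempotentElem (e a)) : Type where
  idx : V

namespace LinCatOf

variable {e : V → A} (he : ∀ a, IsIdempotentElem (e a))

instance : Category (LinCatOf k he) where
  Hom a b := cornerSpace k e a.idx b.idx
  id a := ⟨e a.idx, by
    change e a.idx * e a.idx * e a.idx = e a.idx
    rw [(he _).eq, (he _).eq]⟩
  comp {a b c} x y := ⟨y.1 * x.1, by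
    change e c.idx * (y.1 * x.1) * e a.idx = y.1 * x.1
    rw [← mul_assoc, corner_left_mul he y.2, mul_assoc, corner_mul_right he x.2]⟩
  id_comp x := Subtype.ext (corner_mul_right he x.2)
  comp_id x := Subtype.ext (corner_left_mul he x.2)
  assoc x y z := Subtype.ext (mul_assoc z.1 y.1 x.1).symm

instance : Preadditive (LinCatOf k he) where
  homGroup a b := inferInstanceAs (AddCommGroup (cornerSpace k e a.idx b.idx))
  add_comp _ _ _ x x' y := Subtype.ext (mul_add y.1 x.1 x'.1)
  comp_add _ _ _ x y y' := Subtype.ext (add_mul y.1 y'.1 x.1)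

instance : Linear k (LinCatOf k he) where
  homModule a b := inferInstanceAs (Module k (cornerSpace k e a.idx b.idx))
  smul_comp _ _ _ c x y := Subtype.ext (mul_smul_comm c y.1 x.1)
  comp_smul _ _ _ x c y := Subtype.ext (smul_mul_assoc c y.1 x.1)

end LinCatOf

variable {k}

/-- The morphism of graphs from `V` to `𝓛(A)` which is the identity on vertices and sends the
arrow `x : a ⟶ b` to `d x ∈ e_b A e_a`. -/
def toLinCatOf [Quiver.{0} V] {e : V → A} (he : ∀ a, IsIdempotentElem (e a))
    (d : ∀ ⦃a b : V⦄, (a ⟶ b) → cornerSpace k e a b) : V ⥤q LinCatOf k he where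
  obj a := ⟨a⟩
  map x := d x

variable (k) in
/-- The subspace `(e_b + Rad² A) (Rad A / Rad² A) (e_a + Rad² A)` of `A / Rad² A`. -/
noncomputable def arrowSpace (e : V → A) (a b : V) :
    Submodule k (A ⧸ radSq k A) :=
  ((rad k A).map (LinearMap.mulLeftRight k (e b, e a))).map
    (radSq k A).mkQ

/-- `V` is the ordinary quiver of the split basic algebra `A`, where the vertices are identified
with the complete set `e` of primitive orthogonal idempotents and the arrows are identified, through
`d`, with elements of `e_b (Rad A) e_a`: for all vertices `a` and `b`, the classes of the arrows from
`a` to `b` form a basis of `(e_b + Rad² A) (Rad A / Rad² A) (e_a + Rad² A)`. -/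
structure IsOrdinaryQuiver [Quiver.{0} V] [Fintype V] (e : V → A)
    (d : ∀ ⦃a b : V⦄, (a ⟶ b) → cornerSpace k e a b) : Prop where
  isSplitBasic : IsSplitBasic k A
  complete : CompleteOrthogonalIdempotents e
  primitive : ∀ a, IsPrimitiveIdempotent (e a)
  arrow_mem : ∀ (a b : V) (x : a ⟶ b), (d x : A) ∈ rad k A
  linearIndependent : ∀ a b : V, LinearIndependent k fun x : a ⟶ b =>
    (radSq k A).mkQ (d x : A)
  span_eq : ∀ a b : V, Submodule.span k (Set.range fun x : a ⟶ b =>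
    (radSq k A).mkQ (d x : A)) = arrowSpace k e a b

/-- `(V, R)` is a quiver presentation of the split basic algebra `A` by the elements `d x`: the
quiver `V` is the ordinary quiver of `A`, and `(V, R)` is a presentation of the `k`-linear category
`𝓛(A)`. -/
structure IsQuiverPresentationBy [Quiver.{0} V] [Fintype V] (e : V → A)
    (d : ∀ ⦃a b : V⦄, (a ⟶ b) → cornerSpace k e a b) (R : HomRel (FreeLinCat k V)) : Prop where
  isOrdinaryQuiver : IsOrdinaryQuiver e d
  isPresentation : IsLinPresentation k (toLinCatOf isOrdinaryQuiver.complete.idem d) R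

variable (k) in
/-- `(V, R)` is a quiver presentation of the algebra `A`, which need not be basic: `A` is Morita
equivalent to a split basic algebra `B` of which `(V, R)` is a quiver presentation. -/
def IsQuiverPresentation (A : Type v) [Ring A] [Algebra k A] (V : Type) [Quiver.{0} V] [Fintype V]
    (R : HomRel (FreeLinCat k V)) : Prop :=
  ∃ (B : Type v) (_ : Ring B) (_ : Algebra k B), IsMoritaEquivalent k A B ∧
    ∃ (e : V → B) (d : ∀ ⦃a b : V⦄, (a ⟶ b) → cornerSpace k e a b), IsQuiverPresentationBy e d R

end Algebra

/-! ### Category algebras -/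

section CategoryAlgebra

/-- The set of all morphisms of a category. -/
abbrev Mor (E : Type) [Category.{0} E] : Type := Σ a b : E, a ⟶ b

/-- The category algebra `kE`: the vector space with basis the morphisms of `E`. -/
def CategoryAlgebra (k : Type u) [Field k] (E : Type) [Category.{0} E] : Type u := Mor E →₀ k

namespace CategoryAlgebra

variable (k : Type u) [Field k] {E : Type} [Category.{0} E]

noncomputable instance : AddCommGroup (CategoryAlgebra k E) :=
  inferInstanceAs (AddCommGroup (Mor E →₀ k))

noncomputable instance : Module k (CategoryAlgebra k E) :=
  inferInstanceAs (Module k (Mor E →₀ k))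

/-- The basis element of `kE` given by a morphism of `E`. -/
noncomputable def single {a b : E} (f : a ⟶ b) : CategoryAlgebra k E :=
  Finsupp.single (⟨a, b, f⟩ : Mor E) (1 : k)

open Classical in
/-- The product `g · f` of two morphisms in `kE`: the composite "first `f`, then `g`" if the domain
of `g` is the range of `f`, and `0` otherwise. -/
noncomputable def basisMul (g f : Mor E) : CategoryAlgebra k E :=
  if h : f.2.1 = g.1 then single k (f.2.2 ≫ eqToHom h ≫ g.2.2) else 0

/-- The multiplication of `kE`, as a bilinear map. -/
noncomputable def mulLin :
    CategoryAlgebra k E →ₗ[k] CategoryAlgebra k E →ₗ[k] CategoryAlgebra k E :=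
  Finsupp.lift (CategoryAlgebra k E →ₗ[k] CategoryAlgebra k E) k (Mor E) fun g =>
    Finsupp.lift (CategoryAlgebra k E) k (Mor E) fun f => basisMul k g f

variable {k}

noncomputable instance : Mul (CategoryAlgebra k E) := ⟨fun x y => mulLin k x y⟩

lemma mul_def (x y : CategoryAlgebra k E) : x * y = mulLin k x y := rfl

lemma single_mul_single_eq {a b b' c : E} (f : a ⟶ b) (g : b' ⟶ c) :
    single k g * single k f = basisMul k ⟨b', c, g⟩ ⟨a, b, f⟩ := by
  have h₁ : mulLin k (single k g) = Finsupp.lift (CategoryAlgebra k E) k (Mor E)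
      fun f => basisMul k ⟨b', c, g⟩ f := by
    refine (Finsupp.lift_apply (CategoryAlgebra k E →ₗ[k] CategoryAlgebra k E) k _ _ _).trans ?_
    refine Eq.trans (Finsupp.sum_single_index ?_) (one_smul k _)
    exact zero_smul k _
  refine (DFunLike.congr_fun h₁ (single k f)).trans ?_
  refine (Finsupp.lift_apply (CategoryAlgebra k E) k _ _ _).trans ?_
  refine Eq.trans (Finsupp.sum_single_index ?_) (one_smul k _)
  exact zero_smul k _

lemma single_mul_single {a b c : E} (f : a ⟶ b) (g : b ⟶ c) :
    single k g * single k f = single k (f ≫ g) := by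
  rw [single_mul_single_eq, basisMul, dif_pos rfl]
  simp

lemma single_mul_single_of_ne {a b b' c : E} (f : a ⟶ b) (g : b' ⟶ c) (h : b ≠ b') :
    single k g * single k f = 0 := by
  rw [single_mul_single_eq, basisMul, dif_neg h]

lemma induction {P : CategoryAlgebra k E → Prop} (zero : P 0)
    (add : ∀ x y, P x → P y → P (x + y))
    (smul_single : ∀ {a b : E} (f : a ⟶ b) (c : k), P (c • single k f))
    (x : CategoryAlgebra k E) : P x := by
  refine Finsupp.induction_linear (motive := P) x zero add fun m c => ?_
  have h : c • single k m.2.2 = (Finsupp.single m c : Mor E →₀ k) :=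
    (Finsupp.smul_single c m (1 : k)).trans (by simp)
  have := smul_single m.2.2 c
  rwa [h] at this

lemma smul_mul (c : k) (x y : CategoryAlgebra k E) : (c • x) * y = c • (x * y) := by
  simp [mul_def]

lemma mul_smul' (c : k) (x y : CategoryAlgebra k E) : x * (c • y) = c • (x * y) := by
  simp [mul_def]

lemma add_mul' (x y z : CategoryAlgebra k E) : (x + y) * z = x * z + y * z := by
  simp [mul_def]

lemma mul_add' (x y z : CategoryAlgebra k E) : x * (y + z) = x * y + x * z := by
  simp [mul_def]

lemma zero_mul' (x : CategoryAlgebra k E) : 0 * x = 0 := by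
  simp [mul_def]

lemma mul_zero' (x : CategoryAlgebra k E) : x * 0 = 0 := by
  simp [mul_def]

noncomputable instance : NonUnitalRing (CategoryAlgebra k E) where
  left_distrib := mul_add'
  right_distrib := add_mul'
  zero_mul := zero_mul'
  mul_zero := mul_zero'
  mul_assoc x y z := by
    induction x using induction with
    | zero => simp only [zero_mul']
    | add x x' hx hx' => simp only [add_mul', hx, hx']
    | @smul_single c' d h r =>
    induction y using induction with
    | zero => simp only [zero_mul', mul_zero']
    | add x x' hx hx' => simp only [add_mul', mul_add', hx, hx']
    | @smul_single b' c g s =>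
    induction z using induction with
    | zero => simp only [mul_zero']
    | add x x' hx hx' => simp only [mul_add', hx, hx']
    | @smul_single a b f t =>
    simp only [smul_mul, mul_smul']
    congr 3
    by_cases h₁ : b = b'
    · subst h₁
      by_cases h₂ : c = c'
      · subst h₂
        simp only [single_mul_single, Category.assoc]
      · rw [single_mul_single, single_mul_single_of_ne _ _ h₂, single_mul_single_of_ne _ _ h₂,
          zero_mul']
    · rw [single_mul_single_of_ne f g h₁, mul_zero']
      by_cases h₂ : c = c'
      · subst h₂
        rw [single_mul_single, single_mul_single_of_ne _ _ h₁]
      · rw [single_mul_single_of_ne _ _ h₂, zero_mul']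

variable [Fintype E]

noncomputable instance : One (CategoryAlgebra k E) := ⟨∑ a : E, single k (𝟙 a)⟩

lemma one_def : (1 : CategoryAlgebra k E) = ∑ a : E, single k (𝟙 a) := rfl

noncomputable instance : Ring (CategoryAlgebra k E) where
  __ := (inferInstance : NonUnitalRing (CategoryAlgebra k E))
  one_mul x := by
    induction x using induction with
    | zero => exact mul_zero' _
    | add x y hx hy => rw [mul_add', hx, hy]
    | @smul_single a b f c =>
      rw [mul_smul', one_def, Finset.sum_mul, Finset.sum_eq_single b
        (fun b' _ h => single_mul_single_of_ne _ _ h.symm) (fun h => absurd (Finset.mem_univ _) h),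
        single_mul_single, Category.comp_id]
  mul_one x := by
    induction x using induction with
    | zero => exact zero_mul' _
    | add x y hx hy => rw [add_mul', hx, hy]
    | @smul_single a b f c =>
      rw [smul_mul, one_def, Finset.mul_sum, Finset.sum_eq_single a
        (fun a' _ h => single_mul_single_of_ne _ _ h) (fun h => absurd (Finset.mem_univ _) h),
        single_mul_single, Category.id_comp]

noncomputable instance : Algebra k (CategoryAlgebra k E) :=
  Algebra.ofModule (fun c x y => smul_mul c x y) (fun c x y => mul_smul' c x y)

/-- The identity morphisms as elements of `kE`. -/
noncomputable def idem (k : Type u) [Field k] (a : E) : CategoryAlgebra k E := single k (𝟙 a)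

lemma single_mem {a b : E} (f : a ⟶ b) : single k f ∈ cornerSpace k (idem k) a b := by
  change single k (𝟙 b) * single k f * single k (𝟙 a) = single k f
  rw [single_mul_single, single_mul_single, Category.comp_id, Category.id_comp]

end CategoryAlgebra

end CategoryAlgebra

/-! ### Order-preserving partial functions and order-preserving surjections -/

section OrderPreserving

/-- The order-preserving partial functions on an `n`-element chain. -/
@[ext]
structure PO (n : ℕ) where
  toPFun : Fin n →. Fin n
  monotone : ∀ x y a b : Fin n, x ≤ y → a ∈ toPFun x → b ∈ toPFun y → a ≤ b

/-- The monoid `PO_n`; the product `g * f` is the composite `g ∘ f` of partial functions. -/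
instance PO.monoid (n : ℕ) : Monoid (PO n) where
  mul g f := ⟨g.toPFun.comp f.toPFun, by
    intro x y a b hxy ha hb
    obtain ⟨a', ha', ha⟩ := Part.mem_bind_iff.1 ha
    obtain ⟨b', hb', hb⟩ := Part.mem_bind_iff.1 hb
    exact g.monotone _ _ _ _ (f.monotone _ _ _ _ hxy ha' hb') ha hb⟩
  one := ⟨PFun.id (Fin n), by
    intro x y a b hxy ha hb
    rw [Part.mem_some_iff.1 ha, Part.mem_some_iff.1 hb]
    exact hxy⟩
  mul_assoc h g f := PO.ext (PFun.comp_assoc _ _ _)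
  one_mul f := PO.ext (PFun.id_comp _)
  mul_one f := PO.ext (PFun.comp_id _)

/-- The objects `[0], [1], …, [n]` of the category `SEO_n`; the object `[m]` is the chain with
`m = card` elements, which is modelled by `Fin m`. -/
@[ext]
structure SEO (n : ℕ) where
  card : ℕ
  card_le : card ≤ n

namespace SEO

/-- The objects of `SEO_n` correspond to the numbers `0, …, n`. -/
def equivFin (n : ℕ) : SEO n ≃ Fin (n + 1) where
  toFun a := ⟨a.card, Nat.lt_succ_of_le a.card_le⟩
  invFun i := ⟨i, Nat.le_of_lt_succ i.2⟩
  left_inv _ := rfl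
  right_inv _ := rfl

instance (n : ℕ) : Fintype (SEO n) := Fintype.ofEquiv _ (equivFin n).symm

/-- The category `SEO_n`: its morphisms are the order-preserving surjective functions. -/
instance (n : ℕ) : Category (SEO n) where
  Hom a b := {f : Fin a.card →o Fin b.card // Function.Surjective f}
  id a := ⟨OrderHom.id, Function.surjective_id⟩
  comp f g := ⟨g.1.comp f.1, g.2.comp f.2⟩

end SEO

/-- The arrows of the quiver: `d m h i` is the arrow `d_{i+1}^m` from `[m + 1]` to `[m]`
(where `m + 1 ≤ n`); the `m` arrows from `[m + 1]` to `[m]` are indexed by `i : Fin m`, that is,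
from `0` instead of `1`. -/
inductive FaceArrow (n : ℕ) : SEO n → SEO n → Type
  | d (m : ℕ) (h : m + 1 ≤ n) (i : Fin m) : FaceArrow n ⟨m + 1, h⟩ ⟨m, Nat.le_of_succ_le h⟩

/-- The vertices `[0], …, [n]` of the quiver. -/
def FaceQuiver (n : ℕ) : Type := SEO n

namespace FaceQuiver

instance (n : ℕ) : Quiver.{0} (FaceQuiver n) where
  Hom a b := FaceArrow n a b

instance (n : ℕ) : Fintype (FaceQuiver n) := inferInstanceAs (Fintype (SEO n))

/-- The vertex `[m]`. -/
def vertex {n : ℕ} (m : ℕ) (h : m ≤ n) : FaceQuiver n := (⟨m, h⟩ : SEO n)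

/-- The arrow `d_{i+1}^m : [m + 1] ⟶ [m]`. -/
def d {n : ℕ} (m : ℕ) (h : m + 1 ≤ n) (i : Fin m) :
    (vertex (m + 1) h : FaceQuiver n) ⟶ vertex m (Nat.le_of_succ_le h) :=
  FaceArrow.d m h i

/-- The morphism of `SEO_n` given by an arrow of the quiver: to `d_{i+1}^m` corresponds the
order-preserving surjection `[m + 1] → [m]` which identifies the (zero-based) elements `i` and
`i + 1`. -/
def toHom {n : ℕ} : {a b : SEO n} → FaceArrow n a b → (a ⟶ b)
  | _, _, FaceArrow.d _ _ i => ⟨⟨i.predAbove, Fin.predAbove_right_monotone i⟩,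
      Fin.predAbove_surjective i⟩

/-- The face relations `d_i d_j = d_{j-1} d_i` for `i < j` (with `j + 1` for `j`, so that `i ≤ j`),
as relations between paths of length two. The path `p ≫ q` is "first `p`, then `q`". -/
inductive FaceRel (n : ℕ) : HomRel (Paths (FaceQuiver n))
  | face (m : ℕ) (h : m + 2 ≤ n) (i j : Fin m) (hij : i ≤ j) :
    FaceRel n
      ((Paths.of (FaceQuiver n)).map (d (m + 1) h j.succ) ≫
        (Paths.of (FaceQuiver n)).map (d m (Nat.le_of_succ_le h) i))
      ((Paths.of (FaceQuiver n)).map (d (m + 1) h i.castSucc) ≫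
        (Paths.of (FaceQuiver n)).map (d m (Nat.le_of_succ_le h) j))

/-- The face relations, as a relation on the free linear category. -/
def faceRel (k : Type u) [Field k] (n : ℕ) : HomRel (FreeLinCat k (FaceQuiver n)) :=
  linRel k (FaceRel n)

/-- The primitive idempotent of `k SEO_n` at a vertex of the quiver: the identity of `[m]`. -/
noncomputable def idem (k : Type u) [Field k] {n : ℕ} (a : FaceQuiver n) :
    CategoryAlgebra k (SEO n) :=
  CategoryAlgebra.idem (E := SEO n) k a

/-- The arrows of the quiver as elements of `k SEO_n`. -/
noncomputable def arrow (k : Type u) [Field k] (n : ℕ) ⦃a b : FaceQuiver n⦄ (x : a ⟶ b) :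
    cornerSpace k (idem k : FaceQuiver n → CategoryAlgebra k (SEO n)) a b :=
  ⟨CategoryAlgebra.single k (toHom x), CategoryAlgebra.single_mem (toHom x)⟩

end FaceQuiver

end OrderPreserving

/-! ### Combinatorics of order-preserving surjections -/

namespace SEO

variable {n : ℕ}

/-! In `SEO_n` every endomorphism is an identity and every other morphism strictly lowers the
cardinality. So `k SEO_n` is filtered by the drop in cardinality. Projection onto the coefficients
of the identities is an algebra map onto a product of copies of `k` with nilpotent kernel, and that
kernel is therefore the radical (`SEO.jacobson_eq_ker`). The square of the radical is spanned by the
morphisms that drop at least two (`SEO.radSq_le`, `SEO.single_mem_radSq`). What survives in `Rad /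
Rad²` are the surjections from `[m + 1]` to `[m]`, and these are the arrows
(`FaceQuiver.isOrdinaryQuiver`).

The face relations suffice because their commuting squares behave like pushouts: if a morphism
factors through two different arrows out of `[m + 2]`, it factors through the whole square
(`SEO.exists_comp_of_degen_comp_eq`). Induction on the size of the source then makes any two paths
with the same composite congruent (`FaceQuiver.rel_of_eval_eq`). Every morphism is the composite of
a path (`FaceQuiver.exists_path`), and linear extension gives the presentation
(`FaceQuiver.isLinPresentation`).

For the Morita equivalence, a partial function is viewed as a surjection from its domain onto its
range. Sending `f` to the sum of its restrictions is an algebra isomorphism from `k PO_n` to the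
algebra of the category of surjections between subsets; it is triangular with respect to restriction
(`SubChain.restrictHom_bijective`). `SEO_n` is a skeleton of that category, so its algebra is a
corner `e A e` with `A e A = A` (`CategoryAlgebra.fullCorner`), and `M ↦ e M` is then an equivalence
of module categories (`FullCorner.isMoritaEquivalent`). -/

@[ext]
lemma hom_ext {a b : SEO n} {f g : a ⟶ b} (h : ∀ x, f.1 x = g.1 x) : f = g :=
  Subtype.ext (OrderHom.ext _ _ (funext h))

lemma comp_apply {a b c : SEO n} (f : a ⟶ b) (g : b ⟶ c) (x : Fin a.card) :
    (f ≫ g).1 x = g.1 (f.1 x) := rfl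

lemma card_le_of_hom {a b : SEO n} (f : a ⟶ b) : b.card ≤ a.card := by
  simpa using Fintype.card_le_of_surjective f.1 f.2

/-- Surjections are epimorphisms; this allows a common first arrow to be removed from two paths. -/
lemma cancel_left {a b c : SEO n} (f : a ⟶ b) {g h : b ⟶ c} (e : f ≫ g = f ≫ h) : g = h := by
  ext y
  obtain ⟨x, rfl⟩ := f.2 y
  rw [← comp_apply, e, comp_apply]

/-- A surjective self-map of a finite set is bijective, and a finite chain has no order automorphism
but the identity. -/
lemma endo_eq_id {a : SEO n} (f : a ⟶ a) : f = 𝟙 a := by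
  have hb : Function.Bijective f.1 := Finite.surjective_iff_bijective.1 f.2
  have hs : StrictMono f.1 := f.1.monotone.strictMono_of_injective hb.1
  have h : (StrictMono.orderIsoOfSurjective f.1 hs f.2) = OrderIso.refl _ := Subsingleton.elim _ _
  ext x
  exact congrArg Fin.val (DFunLike.congr_fun h x)

/-- The order-preserving surjection `[m + 1] → [m]` identifying `i` and `i + 1`. -/
def degen (m : ℕ) (h : m + 1 ≤ n) (i : Fin m) :
    (⟨m + 1, h⟩ : SEO n) ⟶ ⟨m, Nat.le_of_succ_le h⟩ :=
  FaceQuiver.toHom (FaceArrow.d m h i)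

lemma val_degen_apply (m : ℕ) (h : m + 1 ≤ n) (i : Fin m) (x : Fin (m + 1)) :
    ((degen m h i).1 x : ℕ) = if (i : ℕ) < x then (x : ℕ) - 1 else x := by
  change ((i.predAbove x : Fin m) : ℕ) = _
  simp only [Fin.predAbove, Fin.lt_def, Fin.val_castSucc]
  split_ifs <;> simp

lemma degen_comp_degen (m : ℕ) (h : m + 2 ≤ n) (i j : Fin m) (hij : i ≤ j) :
    degen (m + 1) h j.succ ≫ degen m (Nat.le_of_succ_le h) i =
      degen (m + 1) h i.castSucc ≫ degen m (Nat.le_of_succ_le h) j := by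
  ext x
  have := Fin.le_def.1 hij
  rw [comp_apply, comp_apply, val_degen_apply, val_degen_apply, val_degen_apply, val_degen_apply]
  simp only [Fin.val_succ, Fin.val_castSucc]
  split_ifs <;> omega

lemma degen_injective (m : ℕ) (h : m + 1 ≤ n) : Function.Injective (degen m h) := by
  have key : ∀ i j : Fin m, i < j → degen m h i ≠ degen m h j := by
    intro i j hij e
    -- The point `i + 1` tells the two maps apart: the first lowers it to `i`, the second fixes it
    -- because `i < j`.
    have := congrArg (fun f : (⟨m + 1, h⟩ : SEO n) ⟶ ⟨m, Nat.le_of_succ_le h⟩ =>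
      (f.1 i.succ : ℕ)) e
    have hij' := Fin.lt_def.1 hij
    have h₁ := val_degen_apply m h i i.succ
    have h₂ := val_degen_apply m h j i.succ
    simp only [Fin.val_succ] at h₁ h₂
    rw [if_pos (by omega)] at h₁
    rw [if_neg (by omega)] at h₂
    dsimp only at this
    omega
  intro i j e
  rcases lt_trichotomy i j with hij | hij | hij
  · exact (key i j hij e).elim
  · exact hij
  · exact (key j i hij e.symm).elim

/-- A morphism identifying `i` and `i + 1` factors through `degen m h i`. -/
lemma exists_degen_comp {m : ℕ} {h : m + 1 ≤ n} {b : SEO n} (f : (⟨m + 1, h⟩ : SEO n) ⟶ b)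
    (i : Fin m) (hi : f.1 i.castSucc = f.1 i.succ) :
    ∃ g : (⟨m, Nat.le_of_succ_le h⟩ : SEO n) ⟶ b, f = degen m h i ≫ g := by
  -- `i.succ.succAbove` is the section of `i.predAbove` that omits `i + 1`. Collapsing and then
  -- applying the section moves only `i + 1`, to `i`, and `f` does not see the difference. The
  -- factor is `f` restricted along this section.
  have key : ∀ x : Fin (m + 1), f.1 (i.succ.succAbove (i.predAbove x)) = f.1 x := by
    intro x
    rcases eq_or_ne x i.succ with rfl | hx
    · rw [Fin.predAbove_succ_self, Fin.succAbove_of_castSucc_lt _ _ Fin.castSucc_lt_succ, hi]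
    · congr 1
      have hx' : (x : ℕ) ≠ i + 1 := fun h => hx (Fin.ext h)
      ext
      simp only [Fin.succAbove, Fin.predAbove, Fin.lt_def, Fin.val_castSucc, Fin.val_succ]
      split_ifs <;> (simp_all; try omega)
  let g : Fin m →o Fin b.card :=
    f.1.comp (OrderEmbedding.toOrderHom (Fin.succAboveOrderEmb i.succ))
  refine ⟨⟨g, fun y => ?_⟩, ?_⟩
  · obtain ⟨x, rfl⟩ := f.2 y
    exact ⟨i.predAbove x, key x⟩
  · ext x
    exact congrArg Fin.val (key x).symm

/-- The pushout property of a face square. The right-hand composite identifies `j + 1` and `j + 2`,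
which `degen (m + 1) h i.castSucc` carries to `j` and `j + 1`; so `u` identifies the latter two and
factors through `degen m _ j`. The formula for `v` follows by cancelling an epimorphism. -/
lemma exists_comp_of_degen_comp_eq {m : ℕ} {h : m + 2 ≤ n} {b : SEO n} {i j : Fin m} (hij : i ≤ j)
    {u v : (⟨m + 1, Nat.le_of_succ_le h⟩ : SEO n) ⟶ b}
    (e : degen (m + 1) h i.castSucc ≫ u = degen (m + 1) h j.succ ≫ v) :
    ∃ t : (⟨m, Nat.le_of_succ_le (Nat.le_of_succ_le h)⟩ : SEO n) ⟶ b,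
      u = degen m (Nat.le_of_succ_le h) j ≫ t ∧ v = degen m (Nat.le_of_succ_le h) i ≫ t := by
  have hij' := Fin.le_def.1 hij
  have h₁ : (degen (m + 1) h i.castSucc).1 j.castSucc.succ = j.castSucc := by
    ext
    rw [val_degen_apply]
    simp only [Fin.val_succ, Fin.val_castSucc]
    split_ifs <;> omega
  have h₂ : (degen (m + 1) h i.castSucc).1 j.succ.succ = j.succ := by
    ext
    rw [val_degen_apply]
    simp only [Fin.val_succ, Fin.val_castSucc]
    split_ifs <;> omega
  have h₃ : (degen (m + 1) h j.succ).1 j.castSucc.succ = (degen (m + 1) h j.succ).1 j.succ.succ := by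
    ext
    rw [val_degen_apply, val_degen_apply]
    simp only [Fin.val_succ, Fin.val_castSucc]
    split_ifs <;> omega
  obtain ⟨t, rfl⟩ := exists_degen_comp u j (by
    rw [← h₁, ← h₂, ← comp_apply, e, comp_apply, h₃, ← comp_apply, ← e, comp_apply])
  refine ⟨t, rfl, cancel_left (degen (m + 1) h j.succ) ?_⟩
  rw [← e, ← Category.assoc, ← Category.assoc, degen_comp_degen m h i j hij]

lemma exists_eq_succ {m : ℕ} {h : m + 1 ≤ n} {b : SEO n} (f : (⟨m + 1, h⟩ : SEO n) ⟶ b)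
    (hb : b.card < m + 1) : ∃ i : Fin m, f.1 i.castSucc = f.1 i.succ := by
  by_contra! hne
  have hs : StrictMono f.1 := Fin.strictMono_iff_lt_succ.2 fun i =>
    lt_of_le_of_ne (f.1.monotone (Fin.castSucc_lt_succ).le) (hne i)
  have := Fintype.card_le_of_injective f.1 hs.injective
  simp at this
  omega

lemma exists_eq_degen_comp {m : ℕ} {h : m + 1 ≤ n} {b : SEO n} (f : (⟨m + 1, h⟩ : SEO n) ⟶ b)
    (hb : b.card < m + 1) :
    ∃ (i : Fin m) (g : (⟨m, Nat.le_of_succ_le h⟩ : SEO n) ⟶ b), f = degen m h i ≫ g :=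
  let ⟨i, hi⟩ := exists_eq_succ f hb
  ⟨i, exists_degen_comp f i hi⟩

end SEO

/-! ### Paths in the quiver of faces -/

namespace FaceQuiver

variable {n : ℕ}

/-- The inclusion of the quiver into `SEO_n`. -/
@[simps]
def inclusion (n : ℕ) : FaceQuiver n ⥤q SEO n where
  obj a := a
  map x := toHom x

/-- The composite in `SEO_n` of a path of the quiver. -/
abbrev eval (n : ℕ) : Paths (FaceQuiver n) ⥤ SEO n := Paths.lift (inclusion n)

/-- The arrow `d m h i` as a path of length one. -/
abbrev step (m : ℕ) (h : m + 1 ≤ n) (i : Fin m) :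
    ((Paths.of (FaceQuiver n)).obj (vertex (m + 1) h) ⟶
      (Paths.of (FaceQuiver n)).obj (vertex m (Nat.le_of_succ_le h))) :=
  (Paths.of (FaceQuiver n)).map (d m h i)

lemma eval_step (m : ℕ) (h : m + 1 ≤ n) (i : Fin m) :
    (eval n).map (step m h i) = SEO.degen m h i :=
  Category.id_comp (SEO.degen m h i)

lemma eval_step_comp {m : ℕ} {h : m + 1 ≤ n} {i : Fin m} {b : Paths (FaceQuiver n)}
    (p : (Paths.of (FaceQuiver n)).obj (vertex m (Nat.le_of_succ_le h)) ⟶ b) :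
    (eval n).map (step m h i ≫ p) = SEO.degen m h i ≫ (eval n).map p :=
  ((eval n).map_comp _ _).trans (congrArg (· ≫ (eval n).map p) (eval_step m h i))

/-- The number of elements of a vertex. -/
def size (a : FaceQuiver n) : ℕ := SEO.card a

lemma size_of_arrow {a b : FaceQuiver n} (e : a ⟶ b) : size b + 1 = size a := by
  change FaceArrow n a b at e
  cases e
  rfl

/-- Each arrow lowers the size by one, so the endpoints determine the length; a path between
vertices of equal size is trivial. -/
lemma length_add_size {a b : FaceQuiver n} (p : Quiver.Path a b) :
    p.length + size b = size a := by
  induction p with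
  | nil => simp
  | cons p e ih =>
    rw [← ih]
    rw [Quiver.Path.length_cons, add_assoc, ← size_of_arrow e, add_comm 1]

lemma exists_step_comp {m : ℕ} {h : m + 1 ≤ n} {b : FaceQuiver n}
    (p : Quiver.Path (vertex (m + 1) h) b) (hb : size b < m + 1) :
    ∃ (i : Fin m) (q : Quiver.Path (vertex m (Nat.le_of_succ_le h)) b),
      p = Quiver.Path.comp (d m h i).toPath q := by
  have hl := length_add_size p
  have hp : p.length ≠ 0 := by
    change p.length + size b = m + 1 at hl
    omega
  obtain ⟨c, e, q, rfl, -⟩ := (Quiver.Path.length_ne_zero_iff_eq_comp p).1 hp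
  -- The type of `q` mentions `c`, which `cases e` has to replace by `[m]`.
  revert q
  change FaceArrow n ⟨m + 1, h⟩ c at e
  cases e with
  | d _ _ i => exact fun q _ _ => ⟨i, q, rfl⟩

/-- Every order-preserving surjection is a composite of arrows. -/
lemma exists_path : ∀ (m : ℕ) (h : m ≤ n) (b : FaceQuiver n) (f : (⟨m, h⟩ : SEO n) ⟶ b),
    ∃ p : (Paths.of (FaceQuiver n)).obj (vertex m h) ⟶ (Paths.of (FaceQuiver n)).obj b,
      (eval n).map p = f := by
  intro m
  induction m with
  | zero =>
    intro h b f
    obtain ⟨c, hc⟩ := b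
    obtain rfl : c = 0 := Nat.le_zero.1 (SEO.card_le_of_hom f)
    exact ⟨𝟙 _, (SEO.endo_eq_id f).symm⟩
  | succ m ih =>
    intro h b f
    rcases (SEO.card_le_of_hom f).lt_or_eq with hb | hb
    · obtain ⟨i, g, rfl⟩ := SEO.exists_eq_degen_comp f hb
      obtain ⟨p, rfl⟩ := ih _ _ g
      exact ⟨step m h i ≫ p, eval_step_comp p⟩
    · obtain ⟨c, hc⟩ := b
      obtain rfl : c = m + 1 := hb
      exact ⟨𝟙 _, (SEO.endo_eq_id f).symm⟩

/-- A congruence on paths containing the face relations identifies all paths with the same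
composite. -/
lemma rel_of_eval_eq (r : HomRel (Paths (FaceQuiver n))) [Congruence r]
    (hr : ∀ (m : ℕ) (h : m + 2 ≤ n) (i j : Fin m), i ≤ j →
      r (step (m + 1) h j.succ ≫ step m (Nat.le_of_succ_le h) i)
        (step (m + 1) h i.castSucc ≫ step m (Nat.le_of_succ_le h) j)) :
    ∀ (m : ℕ) (h : m ≤ n) (b : FaceQuiver n)
      (p q : (Paths.of (FaceQuiver n)).obj (vertex m h) ⟶ (Paths.of (FaceQuiver n)).obj b),
      (eval n).map p = (eval n).map q → r p q := by
  have hnil : ∀ (m : ℕ) (h : m ≤ n) (b : FaceQuiver n)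
      (p q : (Paths.of (FaceQuiver n)).obj (vertex m h) ⟶ (Paths.of (FaceQuiver n)).obj b),
      size b = m → r p q := by
    rintro m h ⟨c, hc⟩ p q rfl
    have hp : ∀ p : Quiver.Path (V := FaceQuiver n) (vertex c hc) (vertex c hc),
        p = Quiver.Path.nil := fun p => Quiver.Path.eq_nil_of_length_zero p (by
      have := length_add_size p
      omega)
    rw [(hp p).trans (hp q).symm]
    exact Congruence.equivalence.refl _
  intro m
  induction m with
  | zero =>
    intro h b p q _
    exact hnil 0 h b p q (Nat.le_zero.1 (SEO.card_le_of_hom ((eval n).map p)))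
  | succ m ih =>
    intro h b p q e
    rcases (SEO.card_le_of_hom ((eval n).map p)).lt_or_eq with hb | hb
    swap
    · exact hnil _ h b p q hb
    obtain ⟨i, p, rfl⟩ := exists_step_comp p hb
    obtain ⟨j, q, rfl⟩ := exists_step_comp q hb
    change r (step m h i ≫ p) (step m h j ≫ q)
    replace e : (eval n).map (step m h i ≫ p) = (eval n).map (step m h j ≫ q) := e
    -- The diamond argument. The common composite factors through the face square by some `g`, which
    -- is lifted to a path `t`. By induction `p` is congruent to `d_j` followed by `t`, and `q` to
    -- `d_i` followed by `t`; the face relation joins the two.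
    have key : ∀ (i j : Fin m)
        (p q : (Paths.of (FaceQuiver n)).obj (vertex m (Nat.le_of_succ_le h)) ⟶
          (Paths.of (FaceQuiver n)).obj b), i < j →
        (eval n).map (step m h i ≫ p) = (eval n).map (step m h j ≫ q) →
        r (step m h i ≫ p) (step m h j ≫ q) := by
      clear e i j p q hb
      intro i j p q hij e
      -- From `i < j`, the index `j` is a successor and `i` is not the last element, so both take
      -- the form used in the face relation.
      obtain ⟨m, rfl⟩ : ∃ m', m = m' + 1 := ⟨m - 1, by have := i.2; omega⟩
      obtain ⟨j, rfl⟩ := Fin.exists_succ_eq.2 (Fin.ne_zero_of_lt hij)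
      obtain ⟨i, rfl⟩ := Fin.exists_castSucc_eq.2 (Fin.ne_last_of_lt hij)
      have hij' : i ≤ j := Nat.lt_succ_iff.1 hij
      obtain ⟨g, hp, hq⟩ := SEO.exists_comp_of_degen_comp_eq hij'
        ((eval_step_comp p).symm.trans (e.trans (eval_step_comp q)))
      obtain ⟨t, rfl⟩ := exists_path _ _ _ g
      replace hp : r p (step m (Nat.le_of_succ_le h) j ≫ t) :=
        ih _ _ _ _ (hp.trans (eval_step_comp t).symm)
      replace hq : r q (step m (Nat.le_of_succ_le h) i ≫ t) :=
        ih _ _ _ _ (hq.trans (eval_step_comp t).symm)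
      have h₁ := HomRel.comp_left (r := r) (step (m + 1) h i.castSucc) hp
      have h₂ := HomRel.comp_left (r := r) (step (m + 1) h j.succ) hq
      have h₃ : r (step (m + 1) h j.succ ≫ step m (Nat.le_of_succ_le h) i ≫ t)
          (step (m + 1) h i.castSucc ≫ step m (Nat.le_of_succ_le h) j ≫ t) := by
        have := HomRel.comp_right (r := r) t (hr m h i j hij')
        rwa [Category.assoc, Category.assoc] at this
      exact Congruence.equivalence.trans h₁
        (Congruence.equivalence.trans (Congruence.equivalence.symm h₃)
          (Congruence.equivalence.symm h₂))
    rcases lt_trichotomy i j with hij | rfl | hij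
    · exact key i j p q hij e
    · refine HomRel.comp_left (r := r) _ (ih _ _ p q ?_)
      exact SEO.cancel_left _ ((eval_step_comp p).symm.trans (e.trans (eval_step_comp q)))
    · exact Congruence.equivalence.symm (key j i q p hij e.symm)

end FaceQuiver

/-! ### The linear category of a category algebra -/

namespace CategoryAlgebra

variable (k : Type u) [Field k] {E : Type} [Category.{0} E]

lemma idem_mul_mul_idem_mem_span (a b : E) (x : CategoryAlgebra k E) :
    idem k b * x * idem k a ∈ Submodule.span k (Set.range fun f : a ⟶ b => single k f) := by
  induction x using induction with
  | zero => simp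
  | add x y hx hy =>
    rw [mul_add, add_mul]
    exact add_mem hx hy
  | @smul_single a' b' f c =>
    rw [mul_smul', smul_mul]
    refine Submodule.smul_mem _ _ ?_
    by_cases hb : b' = b
    · subst hb
      rw [idem, single_mul_single, Category.comp_id]
      by_cases ha : a = a'
      · subst ha
        rw [idem, single_mul_single, Category.id_comp]
        exact Submodule.subset_span ⟨f, rfl⟩
      · rw [idem, single_mul_single_of_ne _ _ ha]
        exact zero_mem _
    · rw [idem, single_mul_single_of_ne _ _ hb, zero_mul]
      exact zero_mem _

variable {k}

/-- The map `o` lets the idempotents be indexed by the vertices of the quiver rather than by the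
objects of `E`. -/
lemma mem_span_of_mem_cornerSpace [Fintype E] {V : Type} (o : V → E) {a b : V} {x : CategoryAlgebra k E}
    (hx : x ∈ cornerSpace k (fun v => idem k (o v)) a b) :
    x ∈ Submodule.span k (Set.range fun f : o a ⟶ o b => single k f) := by
  have h : idem k (o b) * x * idem k (o a) = x := hx
  rw [← h]
  exact idem_mul_mul_idem_mem_span k _ _ x

end CategoryAlgebra

/-! ### The presentation of the linear category of `k SEO_n` -/

namespace FaceQuiver

variable (k : Type u) [Field k] {n : ℕ}

variable (he : ∀ a : FaceQuiver n, IsIdempotentElem (idem k a))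

/-- The morphism of graphs from the quiver to the linear category of `k SEO_n`. -/
noncomputable abbrev graphMap : FaceQuiver n ⥤q LinCatOf k he := toLinCatOf he (arrow k n)

lemma lift_map_path {X Y : Paths (FaceQuiver n)} (p : X ⟶ Y) :
    ((Paths.lift (graphMap k he)).map p).1 = CategoryAlgebra.single k ((eval n).map p) := by
  induction p using Quiver.Path.rec with
  | nil => rfl
  | cons p e ih =>
    refine (congrArg (CategoryAlgebra.single k (toHom e) * ·) ih).trans ?_
    exact CategoryAlgebra.single_mul_single _ _

lemma comp_congr {X Y Z : Paths (FaceQuiver n)} (p : X ⟶ Y) (q : Y ⟶ Z) :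
    (Free.embedding k (Paths (FaceQuiver n))).map (p ≫ q) =
      (Free.embedding k (Paths (FaceQuiver n))).map p ≫
        (Free.embedding k (Paths (FaceQuiver n))).map q :=
  (Free.embedding k (Paths (FaceQuiver n))).map_comp p q

lemma eval_face (m : ℕ) (h : m + 2 ≤ n) (i j : Fin m) (hij : i ≤ j) :
    (eval n).map (step (m + 1) h j.succ ≫ step m (Nat.le_of_succ_le h) i) =
      (eval n).map (step (m + 1) h i.castSucc ≫ step m (Nat.le_of_succ_le h) j) := by
  refine (eval_step_comp _).trans (Eq.trans ?_ (eval_step_comp _).symm)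
  exact (congrArg (SEO.degen (m + 1) h j.succ ≫ ·) (eval_step m _ i)).trans
    ((SEO.degen_comp_degen m h i j hij).trans
      (congrArg (SEO.degen (m + 1) h i.castSucc ≫ ·) (eval_step m _ j)).symm)

/-- Paths with the same composite are congruent. -/
lemma linCongr_of_eval_eq {X Y : Paths (FaceQuiver n)} (p q : X ⟶ Y)
    (h : (eval n).map p = (eval n).map q) :
    LinCongr k (faceRel k n) ((Free.embedding k (Paths (FaceQuiver n))).map p)
      ((Free.embedding k (Paths (FaceQuiver n))).map q) := by
  -- The linear congruence pulled back to paths is itself a congruence, so the combinatorial result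
  -- applies to it.
  let r : HomRel (Paths (FaceQuiver n)) := fun X Y p q =>
    LinCongr k (faceRel k n) ((Free.embedding k (Paths (FaceQuiver n))).map p)
      ((Free.embedding k (Paths (FaceQuiver n))).map q)
  have : Congruence r :=
    { equivalence := ⟨fun _ => LinCongr.refl _, LinCongr.symm, LinCongr.trans⟩
      comp_left := fun f _ _ h => by
        change LinCongr k _ _ _
        rw [comp_congr, comp_congr]
        exact LinCongr.comp (LinCongr.refl _) h
      comp_right := fun g h => by
        change LinCongr k _ _ _
        rw [comp_congr, comp_congr]
        exact LinCongr.comp h (LinCongr.refl _) }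
  exact rel_of_eval_eq r (fun m h i j hij => LinCongr.rel (linRel.of (FaceRel.face m h i j hij)))
    (size X) (SEO.card_le X) Y p q h

open Classical in
/-- A linear section, up to congruence, of the linear extension of `eval`. -/
noncomputable def pathSection (X Y : Paths (FaceQuiver n)) :
    CategoryAlgebra k (SEO n) →ₗ[k] ((X ⟶ Y) →₀ k) :=
  Finsupp.lift ((X ⟶ Y) →₀ k) k (Mor (SEO n)) fun g =>
    if h : ∃ p : X ⟶ Y, g = ⟨(eval n).obj X, (eval n).obj Y, (eval n).map p⟩ then
      Finsupp.single h.choose 1 else 0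

/-- The chosen path may differ from `p`, but it has the same composite, which is enough up to
congruence. -/
lemma exists_pathSection_single {X Y : Paths (FaceQuiver n)} (p : X ⟶ Y) :
    ∃ q : X ⟶ Y, (eval n).map p = (eval n).map q ∧
      pathSection k X Y (CategoryAlgebra.single k ((eval n).map p)) = Finsupp.single q 1 := by
  classical
  have h : ∃ q : X ⟶ Y,
      (⟨(eval n).obj X, (eval n).obj Y, (eval n).map p⟩ : Mor (SEO n)) =
        ⟨(eval n).obj X, (eval n).obj Y, (eval n).map q⟩ := ⟨p, rfl⟩
  refine ⟨h.choose, ?_, ?_⟩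
  · simpa using h.choose_spec
  · refine (Finsupp.lift_apply ((X ⟶ Y) →₀ k) k _ _ _).trans ?_
    refine (Finsupp.sum_single_index ?_).trans ?_
    · exact zero_smul k _
    rw [one_smul, dif_pos h]

/-- The right-hand side depends only on the image of `f`, so combinations with equal images are
congruent. This is the faithfulness of the induced functor. -/
lemma linCongr_pathSection {X Y : FreeLinCat k (FaceQuiver n)} (f : X ⟶ Y) :
    LinCongr k (faceRel k n) f
      (pathSection k X Y (freeLinMap k (graphMap k he) X Y f).1 : (X ⟶ Y)) := by
  induction f using Finsupp.induction_linear with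
  | zero =>
    have : (pathSection k X Y (freeLinMap k (graphMap k he) X Y 0).1) = 0 := by
      rw [map_zero]
      exact map_zero _
    rw [this]
    exact LinCongr.refl _
  | add a b ha hb =>
    have : (pathSection k X Y (freeLinMap k (graphMap k he) X Y (a + b)).1) =
        pathSection k X Y (freeLinMap k (graphMap k he) X Y a).1 +
          pathSection k X Y (freeLinMap k (graphMap k he) X Y b).1 := by
      rw [map_add]
      exact map_add _ _ _
    rw [this]
    exact LinCongr.add ha hb
  | single p c =>
    obtain ⟨q, hq, hs⟩ := exists_pathSection_single k p
    have : (pathSection k X Y (freeLinMap k (graphMap k he) X Y (Finsupp.single p c)).1) =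
        c • Finsupp.single q 1 := by
      refine Eq.trans ?_ (congrArg (c • ·) hs)
      refine Eq.trans ?_ (map_smul (pathSection k X Y) c _)
      refine congrArg (pathSection k X Y) ?_
      refine (congrArg Subtype.val (freeLinMap_single k (graphMap k he) p c)).trans ?_
      exact congrArg (c • ·) (lift_map_path k he p)
    rw [this]
    have h : (Finsupp.single p c : X ⟶ Y) = c • (Finsupp.single p 1 : X ⟶ Y) := by
      refine Eq.trans ?_ (Finsupp.smul_single c p (1 : k)).symm
      rw [smul_eq_mul, mul_one]
    rw [h]
    exact LinCongr.smul c (linCongr_of_eval_eq k p q hq)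

lemma freeLinLift_respects (X Y : FreeLinCat k (FaceQuiver n)) (f g : X ⟶ Y)
    (h : LinCongr k (faceRel k n) f g) :
    (freeLinLift k (graphMap k he)).map f = (freeLinLift k (graphMap k he)).map g := by
  induction h with
  | rel h =>
    obtain ⟨⟨m, h, i, j, hij⟩⟩ := h
    refine (freeLinMap_single k _ _ _).trans (Eq.trans ?_ (freeLinMap_single k _ _ _).symm)
    refine congrArg ((1 : k) • ·) (Subtype.ext ?_)
    refine (lift_map_path k he _).trans (Eq.trans ?_ (lift_map_path k he _).symm)
    refine congrArg (CategoryAlgebra.single k) ?_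
    exact eval_face m h i j hij
  | refl => rfl
  | symm _ ih => exact ih.symm
  | trans _ _ ih₁ ih₂ => exact ih₁.trans ih₂
  | comp _ _ ih₁ ih₂ => rw [Functor.map_comp, Functor.map_comp, ih₁, ih₂]
  | add _ _ ih₁ ih₂ =>
    exact (map_add (freeLinMap k (graphMap k he) _ _) _ _).trans
      ((congrArg₂ (· + ·) ih₁ ih₂).trans (map_add (freeLinMap k (graphMap k he) _ _) _ _).symm)
  | smul c _ ih =>
    exact (map_smul (freeLinMap k (graphMap k he) _ _) c _).trans
      ((congrArg (c • ·) ih).trans (map_smul (freeLinMap k (graphMap k he) _ _) c _).symm)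

lemma toHom_injective {a b : FaceQuiver n} :
    Function.Injective fun x : a ⟶ b => (inclusion n).map x := by
  intro x y hxy
  change FaceArrow n a b at x y
  cases x with
  | d m h i =>
    cases y with
    | d _ _ j =>
      exact congrArg (FaceArrow.d m h)
        (SEO.degen_injective m h (show SEO.degen m h i = SEO.degen m h j from hxy))

lemma single_injective {E : Type} [Category.{0} E] {a b : E} :
    Function.Injective fun f : a ⟶ b => CategoryAlgebra.single k f := by
  intro f g h
  have := (Finsupp.single_left_inj (one_ne_zero : (1 : k) ≠ 0)).1 h
  simpa using this

theorem isLinPresentation :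
    IsLinPresentation k (graphMap k he) (faceRel k n) where
  obj_bijective := ⟨fun _ _ h => congrArg LinCatOf.idx h, fun ⟨a⟩ => ⟨a, rfl⟩⟩
  map_injective a b x y h := toHom_injective (single_injective k (congrArg Subtype.val h))
  respects := freeLinLift_respects k he
  additive := ⟨by
    rintro X Y f g
    obtain ⟨f, rfl⟩ := (CategoryTheory.Quotient.functor _).map_surjective f
    obtain ⟨g, rfl⟩ := (CategoryTheory.Quotient.functor _).map_surjective g
    exact map_add (freeLinMap k (graphMap k he) _ _) f g⟩
  linear := ⟨by
    rintro X Y f c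
    obtain ⟨f, rfl⟩ := (CategoryTheory.Quotient.functor _).map_surjective f
    exact map_smul (freeLinMap k (graphMap k he) _ _) c f⟩
  isEquivalence :=
    { faithful := ⟨by
        rintro X Y f g h
        obtain ⟨f, rfl⟩ := (CategoryTheory.Quotient.functor _).map_surjective f
        obtain ⟨g, rfl⟩ := (CategoryTheory.Quotient.functor _).map_surjective g
        refine (CategoryTheory.Quotient.functor_map_eq_iff _ _ _).2 ?_
        refine (linCongr_pathSection k he f).trans ?_
        have h' : freeLinMap k (graphMap k he) X.as Y.as f =
          freeLinMap k (graphMap k he) X.as Y.as g := h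
        rw [h']
        exact (linCongr_pathSection k he g).symm⟩
      full := ⟨by
        rintro X Y ⟨x, hx⟩
        -- Fullness: the hom-space is spanned by morphisms of `SEO_n`, and each of these is the
        -- composite of a path.
        have := CategoryAlgebra.mem_span_of_mem_cornerSpace (E := SEO n)
          (fun a : FaceQuiver n => a) hx
        suffices h : ∃ f : X.as ⟶ Y.as, (freeLinMap k (graphMap k he) X.as Y.as f).1 = x by
          obtain ⟨f, hf⟩ := h
          exact ⟨(CategoryTheory.Quotient.functor _).map f, Subtype.ext hf⟩
        clear hx
        induction this using Submodule.span_induction with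
        | mem x h =>
          obtain ⟨f, rfl⟩ := h
          obtain ⟨p, rfl⟩ := exists_path _ (SEO.card_le X.as) Y.as f
          exact ⟨Finsupp.single p 1,
            (congrArg Subtype.val (freeLinMap_single k (graphMap k he) p 1)).trans
              ((one_smul k _).trans (lift_map_path k he p))⟩
        | zero => exact ⟨0, congrArg Subtype.val (map_zero (freeLinMap k (graphMap k he) _ _))⟩
        | add x y _ _ hx hy =>
          obtain ⟨f, rfl⟩ := hx
          obtain ⟨g, rfl⟩ := hy
          exact ⟨f + g, congrArg Subtype.val (map_add (freeLinMap k (graphMap k he) _ _) f g)⟩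
        | smul c x _ hx =>
          obtain ⟨f, rfl⟩ := hx
          exact ⟨c • f, congrArg Subtype.val (map_smul (freeLinMap k (graphMap k he) _ _) c f)⟩⟩
      essSurj := ⟨fun Y => ⟨⟨Y.idx⟩, ⟨Iso.refl _⟩⟩⟩ }

end FaceQuiver

/-! ### The radical of `k SEO_n` -/

namespace SEO

open CategoryAlgebra

variable (k : Type u) [Field k] {n : ℕ}

variable (n) in
/-- The span of the morphisms which decrease the cardinality by at least `r`. -/
noncomputable def dropSpan (r : ℕ) : Submodule k (CategoryAlgebra k (SEO n)) :=
  Submodule.span k {x | ∃ (a b : SEO n) (f : a ⟶ b), b.card + r ≤ a.card ∧ x = single k f}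

variable {k}

lemma single_mem_dropSpan {a b : SEO n} (f : a ⟶ b) {r : ℕ} (h : b.card + r ≤ a.card) :
    single k f ∈ dropSpan k n r :=
  Submodule.subset_span ⟨a, b, f, h, rfl⟩

lemma dropSpan_zero : dropSpan k n 0 = ⊤ := by
  refine eq_top_iff.2 fun x _ => ?_
  induction x using CategoryAlgebra.induction with
  | zero => exact zero_mem _
  | add x y hx hy => exact add_mem (hx trivial) (hy trivial)
  | smul_single f c => exact Submodule.smul_mem _ _ (single_mem_dropSpan f (card_le_of_hom f))

lemma dropSpan_eq_bot {r : ℕ} (h : n < r) : dropSpan k n r = ⊥ := by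
  refine eq_bot_iff.2 (Submodule.span_le.2 ?_)
  rintro _ ⟨a, b, f, hf, rfl⟩
  have := a.card_le
  omega

/-- Drops add under composition. As no drop exceeds `n`, the elements of `dropSpan k n 1` are
nilpotent. -/
lemma dropSpan_mul_le (r s : ℕ) : dropSpan k n r * dropSpan k n s ≤ dropSpan k n (r + s) := by
  rw [dropSpan, dropSpan, Submodule.span_mul_span, Submodule.span_le]
  rintro _ ⟨_, ⟨b', c, g, hg, rfl⟩, _, ⟨a, b, f, hf, rfl⟩, rfl⟩
  change single k g * single k f ∈ dropSpan k n (r + s)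
  by_cases h : b = b'
  · subst h
    rw [single_mul_single]
    exact single_mem_dropSpan _ (by omega)
  · rw [single_mul_single_of_ne _ _ h]
    exact zero_mem _

lemma mul_mem_dropSpan {r s : ℕ} {x y : CategoryAlgebra k (SEO n)} (hx : x ∈ dropSpan k n r)
    (hy : y ∈ dropSpan k n s) : x * y ∈ dropSpan k n (r + s) :=
  dropSpan_mul_le r s (Submodule.mul_mem_mul hx hy)

lemma pow_mem_dropSpan {x : CategoryAlgebra k (SEO n)} (hx : x ∈ dropSpan k n 1) (r : ℕ) :
    x ^ r ∈ dropSpan k n r := by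
  induction r with
  | zero => simp [dropSpan_zero]
  | succ r ih => exact pow_succ x r ▸ mul_mem_dropSpan ih hx

variable (k n) in
open Classical in
/-- The coefficients of the identities. -/
noncomputable def diagLin : CategoryAlgebra k (SEO n) →ₗ[k] (SEO n → k) :=
  Finsupp.lift (SEO n → k) k (Mor (SEO n)) fun m c => if m.1 = c ∧ m.2.1 = c then 1 else 0

open Classical in
lemma diagLin_single {a b : SEO n} (f : a ⟶ b) (c : SEO n) :
    diagLin k n (single k f) c = if a = c ∧ b = c then 1 else 0 := by
  have : diagLin k n (single k f) = fun c => if a = c ∧ b = c then 1 else 0 := by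
    refine (Finsupp.lift_apply (SEO n → k) k _ _ _).trans ?_
    refine (Finsupp.sum_single_index ?_).trans ?_
    · exact zero_smul k _
    · exact one_smul k _
  rw [this]

lemma diagLin_one : diagLin k n 1 = 1 := by
  classical
  ext c
  rw [one_def, map_sum, Finset.sum_apply]
  simp [diagLin_single]

lemma diagLin_mul (x y : CategoryAlgebra k (SEO n)) :
    diagLin k n (x * y) = diagLin k n x * diagLin k n y := by
  classical
  induction x using CategoryAlgebra.induction with
  | zero => simp
  | add x y hx hy => simp only [add_mul, map_add, hx, hy]
  | @smul_single b' c g r =>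
  induction y using CategoryAlgebra.induction with
  | zero => simp
  | add x y hx hy => simp only [mul_add, map_add, hx, hy]
  | @smul_single a b f s =>
  simp only [smul_mul_assoc, mul_smul_comm, map_smul]
  congr 2
  ext i
  by_cases h : b = b'
  · subst h
    rw [single_mul_single, Pi.mul_apply, diagLin_single, diagLin_single, diagLin_single]
    have h₁ := card_le_of_hom f
    have h₂ := card_le_of_hom g
    -- Cardinalities decrease along a composite, so one that starts and ends at `i` also passes
    -- through `i`. This makes the diagonal multiplicative.
    have h₃ : a = i → c = i → b = i := by
      rintro rfl h
      have := congrArg SEO.card h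
      exact SEO.ext (by omega)
    by_cases ha : a = i <;> by_cases hb : b = i <;> by_cases hc : c = i <;> simp_all
  · rw [single_mul_single_of_ne _ _ h, Pi.mul_apply, diagLin_single, diagLin_single, map_zero]
    by_cases hb : b = i <;> by_cases hb' : b' = i <;> simp_all

variable (k n) in
/-- The projection of `k SEO_n` onto its semisimple quotient. -/
noncomputable def diag : CategoryAlgebra k (SEO n) →ₐ[k] (SEO n → k) :=
  AlgHom.ofLinearMap (diagLin k n) diagLin_one diagLin_mul

lemma diag_apply (x : CategoryAlgebra k (SEO n)) : diag k n x = diagLin k n x := rfl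

lemma diag_sum_idem (v : SEO n → k) : diag k n (∑ a, v a • idem k a) = v := by
  classical
  ext c
  rw [diag_apply, map_sum, Finset.sum_apply]
  simp [idem, diagLin_single]

lemma diag_surjective : Function.Surjective (diag k n) := fun v => ⟨_, diag_sum_idem v⟩

lemma sub_diag_mem (x : CategoryAlgebra k (SEO n)) :
    x - ∑ a, diag k n x a • idem k a ∈ dropSpan k n 1 := by
  classical
  induction x using CategoryAlgebra.induction with
  | zero => simp
  | add x y hx hy =>
    simp only [map_add, Pi.add_apply, add_smul, Finset.sum_add_distrib]
    rw [add_sub_add_comm]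
    exact add_mem hx hy
  | @smul_single a b f c =>
    simp only [map_smul, Pi.smul_apply, smul_eq_mul, mul_smul]
    rw [← Finset.smul_sum, ← smul_sub]
    refine Submodule.smul_mem _ _ ?_
    simp only [diag_apply, diagLin_single]
    rcases (card_le_of_hom f).lt_or_eq with h | h
    · have hab : a ≠ b := fun e => h.ne (congrArg SEO.card e.symm)
      rw [Finset.sum_eq_zero, sub_zero]
      · exact single_mem_dropSpan f h
      · intro c _
        rw [if_neg, zero_smul]
        rintro ⟨rfl, rfl⟩
        exact hab rfl
    · obtain rfl : b = a := SEO.ext h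
      obtain rfl := endo_eq_id f
      simp [idem]

lemma diag_eq_zero_iff {x : CategoryAlgebra k (SEO n)} :
    diag k n x = 0 ↔ x ∈ dropSpan k n 1 := by
  classical
  refine ⟨fun h => by simpa [h] using sub_diag_mem x, fun h => ?_⟩
  have : dropSpan k n 1 ≤ LinearMap.ker (diagLin k n) := by
    refine Submodule.span_le.2 ?_
    rintro _ ⟨a, b, f, hf, rfl⟩
    ext c
    rw [diagLin_single, if_neg]
    · rfl
    · rintro ⟨rfl, rfl⟩
      omega
  exact this h

/-- The image of `diag` is a product of fields, hence semisimple, which bounds the radical from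
above. Conversely, for `x` in the kernel every `y * x` has positive drop and is nilpotent, so `1 + y
* x` is a unit. -/
lemma jacobson_eq_ker : Ring.jacobson (CategoryAlgebra k (SEO n)) = RingHom.ker (diag k n) := by
  refine le_antisymm ?_ fun x hx => ?_
  · have : RingHomSurjective (diag k n : CategoryAlgebra k (SEO n) →+* (SEO n → k)) :=
      ⟨diag_surjective⟩
    refine (Ring.le_comap_jacobson (diag k n : CategoryAlgebra k (SEO n) →+* (SEO n → k))).trans ?_
    rw [IsSemisimpleRing.jacobson_eq_bot]
    rfl
  · rw [← Ideal.jacobson_bot, Ideal.mem_jacobson_iff]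
    intro y
    have hyx : y * x ∈ dropSpan k n 1 := by
      rw [← diag_eq_zero_iff, map_mul, (RingHom.mem_ker).1 hx, mul_zero]
    have hn : IsNilpotent (y * x) := ⟨n + 1, by
      simpa [dropSpan_eq_bot (Nat.lt_succ_self n)] using pow_mem_dropSpan hyx (n + 1)⟩
    obtain ⟨z, hz⟩ := (hn.isUnit_one_add).exists_left_inv
    refine ⟨z, ?_⟩
    rw [Ideal.mem_bot, sub_eq_zero, mul_assoc, add_comm, ← mul_one_add, hz]

lemma rad_eq : rad k (CategoryAlgebra k (SEO n)) = dropSpan k n 1 := by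
  ext x
  rw [← diag_eq_zero_iff, rad, Submodule.restrictScalars_mem, jacobson_eq_ker]
  exact RingHom.mem_ker

lemma radSq_le : radSq k (CategoryAlgebra k (SEO n)) ≤ dropSpan k n 2 := by
  rw [radSq, rad_eq]
  exact dropSpan_mul_le 1 1

/-- Splitting off one arrow leaves a factor that still drops by at least one. With `radSq_le`, this
identifies the squared radical with `dropSpan k n 2`. -/
lemma single_mem_radSq {a b : SEO n} (f : a ⟶ b) (h : b.card + 2 ≤ a.card) :
    single k f ∈ radSq k (CategoryAlgebra k (SEO n)) := by
  obtain ⟨c, hc⟩ := a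
  obtain ⟨m, rfl⟩ : ∃ m, c = m + 1 := ⟨c - 1, by simp only at h; omega⟩
  simp only at h
  obtain ⟨i, g, rfl⟩ := exists_eq_degen_comp f (by omega)
  rw [← single_mul_single, radSq, rad_eq]
  exact Submodule.mul_mem_mul (single_mem_dropSpan g (by simp only; omega))
    (single_mem_dropSpan _ le_rfl)

instance : Finite (Mor (SEO n)) := by
  have (a b : SEO n) : Finite (a ⟶ b) :=
    Finite.of_injective (fun f x => f.1 x) fun f g h => hom_ext (congrFun h)
  infer_instance

variable (k n) in
lemma isSplitBasic : IsSplitBasic k (CategoryAlgebra k (SEO n)) := by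
  refine ⟨inferInstanceAs (FiniteDimensional k (Mor (SEO n) →₀ k)), n + 1, ⟨?_⟩⟩
  exact ((Ideal.quotientEquivAlgOfEq k jacobson_eq_ker).trans
    (Ideal.quotientKerAlgEquivOfSurjective diag_surjective)).trans
    (AlgEquiv.piCongrLeft k (fun _ => k) (equivFin n))

end SEO

/-! ### Primitive idempotents and the ordinary quiver of `k SEO_n`. -/

namespace FaceQuiver

open CategoryAlgebra

variable (k : Type u) [Field k] {n : ℕ}

lemma completeOrthogonalIdempotents_idem {E : Type} [Category.{0} E] [Fintype E] :
    CompleteOrthogonalIdempotents (CategoryAlgebra.idem k : E → CategoryAlgebra k E) where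
  idem a := by
    rw [IsIdempotentElem, CategoryAlgebra.idem, single_mul_single, Category.id_comp]
  ortho a b h := single_mul_single_of_ne _ _ h.symm
  complete := rfl

/-- The corner `e A e` is the line `k e`, since the only endomorphism is the identity, and a field
has no idempotents except `0` and `1`. -/
lemma isPrimitiveIdempotent_idem (a : SEO n) :
    IsPrimitiveIdempotent (CategoryAlgebra.idem k a) := by
  have hid := (completeOrthogonalIdempotents_idem k (E := SEO n)).idem a
  have hne : CategoryAlgebra.idem k a ≠ 0 := Finsupp.single_ne_zero.2 one_ne_zero
  refine ⟨hid, hne, fun f g hf hg hfg hgf e => ?_⟩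
  have h₁ : CategoryAlgebra.idem k a * f * CategoryAlgebra.idem k a = f := by
    rw [e, add_mul, hf.eq, hgf, add_zero, mul_add, hf.eq, hfg, add_zero]
  have h₂ := idem_mul_mul_idem_mem_span k a a f
  rw [h₁] at h₂
  have h₃ : (Set.range fun x : a ⟶ a => single k x) = {CategoryAlgebra.idem k a} := by
    ext x
    constructor
    · rintro ⟨y, rfl⟩
      rw [SEO.endo_eq_id y]
      rfl
    · rintro rfl
      exact ⟨𝟙 a, rfl⟩
  rw [h₃, Submodule.mem_span_singleton] at h₂
  obtain ⟨c, rfl⟩ := h₂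
  have hc : c * c = c := by
    have := hf.eq
    rw [smul_mul_smul_comm, hid.eq] at this
    exact smul_left_injective k hne this
  rcases IsIdempotentElem.iff_eq_zero_or_one.1 hc with rfl | rfl
  · left
    exact zero_smul k _
  · right
    simpa using e

lemma exists_toHom_eq {a b : SEO n} (f : a ⟶ b) (h : a.card = b.card + 1) :
    ∃ x : FaceArrow n a b, toHom x = f := by
  obtain ⟨c, hc⟩ := a
  obtain ⟨m, hm⟩ := b
  obtain rfl : c = m + 1 := h
  obtain ⟨i, g, rfl⟩ := SEO.exists_eq_degen_comp f (Nat.lt_succ_self m)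
  refine ⟨FaceArrow.d m hc i, ?_⟩
  rw [SEO.endo_eq_id g, Category.comp_id]
  rfl

lemma card_of_arrow {a b : SEO n} (x : FaceArrow n a b) : b.card + 1 = a.card := by
  cases x
  rfl

lemma single_mem_arrow_span {a b : SEO n} (f : a ⟶ b) (h : b.card + 1 ≤ a.card) :
    (radSq k (CategoryAlgebra k (SEO n))).mkQ (single k f) ∈
      Submodule.span k (Set.range fun x : FaceArrow n a b =>
        (radSq k (CategoryAlgebra k (SEO n))).mkQ (single k (toHom x))) := by
  rcases h.lt_or_eq with h | h
  · have h₀ : (radSq k (CategoryAlgebra k (SEO n))).mkQ (single k f) = 0 :=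
      (Submodule.Quotient.mk_eq_zero _).2 (SEO.single_mem_radSq f h)
    rw [h₀]
    exact zero_mem _
  · obtain ⟨x, rfl⟩ := exists_toHom_eq f h.symm
    exact Submodule.subset_span ⟨x, rfl⟩

/-- Multiplying by the two idempotents keeps only the morphisms from `a` to `b`; modulo `Rad²` only
those dropping exactly one survive, and they are arrows. -/
lemma mkQ_idem_mul_mul_idem_mem_span (a b : SEO n) {y : CategoryAlgebra k (SEO n)}
    (hy : y ∈ SEO.dropSpan k n 1) :
    (radSq k (CategoryAlgebra k (SEO n))).mkQ
        (CategoryAlgebra.idem k b * y * CategoryAlgebra.idem k a) ∈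
      Submodule.span k (Set.range fun x : FaceArrow n a b =>
        (radSq k (CategoryAlgebra k (SEO n))).mkQ (single k (toHom x))) := by
  induction hy using Submodule.span_induction with
  | mem y h =>
    obtain ⟨a', b', f, hf, rfl⟩ := h
    by_cases hb : b' = b
    · subst hb
      rw [CategoryAlgebra.idem, single_mul_single, Category.comp_id]
      by_cases ha : a = a'
      · subst ha
        rw [CategoryAlgebra.idem, single_mul_single, Category.id_comp]
        exact single_mem_arrow_span k f hf
      · rw [CategoryAlgebra.idem, single_mul_single_of_ne _ _ ha, map_zero]
        exact zero_mem _
    · rw [CategoryAlgebra.idem, single_mul_single_of_ne _ _ hb, zero_mul, map_zero]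
      exact zero_mem _
  | zero =>
    rw [mul_zero, zero_mul, map_zero]
    exact zero_mem _
  | add x y _ _ hx hy =>
    rw [mul_add, add_mul, map_add]
    exact add_mem hx hy
  | smul c x _ hx =>
    rw [mul_smul_comm, smul_mul_assoc, map_smul]
    exact Submodule.smul_mem _ _ hx

/-- The coefficient of a morphism. -/
noncomputable def coeff {E : Type} [Category.{0} E] (m : Mor E) : CategoryAlgebra k E →ₗ[k] k :=
  Finsupp.lapply m

open Classical in
lemma coeff_single {E : Type} [Category.{0} E] (m : Mor E) {a b : E} (f : a ⟶ b) :
    coeff k m (single k f) = if (⟨a, b, f⟩ : Mor E) = m then 1 else 0 :=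
  Finsupp.single_apply

lemma coeff_eq_zero {m : Mor (SEO n)} {r : ℕ} (hm : m.1.card < m.2.1.card + r)
    {x : CategoryAlgebra k (SEO n)} (hx : x ∈ SEO.dropSpan k n r) : coeff k m x = 0 := by
  classical
  have : SEO.dropSpan k n r ≤ LinearMap.ker (coeff k m) := by
    refine Submodule.span_le.2 ?_
    rintro _ ⟨a, b, f, hf, rfl⟩
    rw [SetLike.mem_coe, LinearMap.mem_ker, coeff_single, if_neg]
    rintro rfl
    exact absurd hm (not_lt.2 hf)
  exact this hx

/-- The coefficient of a morphism that drops by one vanishes on `dropSpan k n 2`, hence on `Rad²`,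
so it detects each arrow modulo `Rad²`. -/
lemma linearIndependent_mkQ_single (a b : SEO n) :
    LinearIndependent k fun x : FaceArrow n a b =>
      (radSq k (CategoryAlgebra k (SEO n))).mkQ (single k (toHom x)) := by
  classical
  rw [linearIndependent_iff']
  intro s c hc x hx
  have h : ∑ y ∈ s, c y • single k (toHom y) ∈ radSq k (CategoryAlgebra k (SEO n)) := by
    refine (Submodule.Quotient.mk_eq_zero _).1 ?_
    refine (map_sum (radSq k (CategoryAlgebra k (SEO n))).mkQ _ _).trans (Eq.trans ?_ hc)
    exact Finset.sum_congr rfl fun y _ => map_smul _ _ _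
  have h' := coeff_eq_zero k (m := ⟨a, b, toHom x⟩)
    (by have := card_of_arrow x; simp only; omega) (SEO.radSq_le h)
  rw [map_sum, Finset.sum_eq_single x, map_smul, coeff_single, if_pos rfl] at h'
  · simpa using h'
  · intro y _ hyx
    rw [map_smul, coeff_single, if_neg, smul_zero]
    intro e
    refine hyx (toHom_injective (a := a) (b := b) ?_)
    exact (by simpa using e : (toHom y : a ⟶ b) = toHom x)
  · exact fun h => (h hx).elim

lemma mkQ_mem_arrowSpace {A : Type v} [Ring A] [Algebra k A] {V : Type} {e : V → A} {a b : V}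
    {x : A} (hx : x ∈ cornerSpace k e a b) (hr : x ∈ rad k A) :
    (radSq k A).mkQ x ∈ arrowSpace k e a b := by
  have h : e b * x * e a = x := hx
  exact ⟨_, ⟨x, hr, rfl⟩, congrArg (radSq k A).mkQ h⟩

theorem isOrdinaryQuiver :
    IsOrdinaryQuiver (idem k : FaceQuiver n → CategoryAlgebra k (SEO n)) (arrow k n) where
  isSplitBasic := SEO.isSplitBasic k n
  complete := completeOrthogonalIdempotents_idem k (E := SEO n)
  primitive a := isPrimitiveIdempotent_idem k (a : SEO n)
  arrow_mem a b x := by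
    rw [SEO.rad_eq]
    exact SEO.single_mem_dropSpan _ (card_of_arrow x).le
  linearIndependent a b := linearIndependent_mkQ_single k (a : SEO n) b
  span_eq a b := by
    refine le_antisymm (Submodule.span_le.2 ?_) ?_
    · rintro _ ⟨x, rfl⟩
      refine mkQ_mem_arrowSpace k (arrow k n x).2 ?_
      rw [SEO.rad_eq]
      exact SEO.single_mem_dropSpan _ (card_of_arrow x).le
    · rintro _ ⟨_, ⟨y, hy, rfl⟩, rfl⟩
      have hy' : y ∈ SEO.dropSpan k n 1 := SEO.rad_eq (k := k) (n := n) ▸ hy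
      have h := mkQ_idem_mul_mul_idem_mem_span k (a : SEO n) b hy'
      have e : (fun x : a ⟶ b => (radSq k (CategoryAlgebra k (SEO n))).mkQ (arrow k n x).1) =
        fun x : FaceArrow n a b =>
          (radSq k (CategoryAlgebra k (SEO n))).mkQ (single k (toHom x)) := rfl
      rw [e]
      exact h

end FaceQuiver

/-! ### Morita equivalence with a full corner -/

/-- A (nonunital) embedding of the algebra `B` onto a corner `e A e` of `A`, where `e` is a full
idempotent of `A`, that is, `A e A = A`. -/
structure FullCorner (k : Type u) [Field k] (A B : Type u) [Ring A] [Algebra k A] [Ring B]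
    [Algebra k B] where
  θ : B →ₙₐ[k] A
  injective : Function.Injective θ
  exists_eq : ∀ x : A, ∃ b, θ b = θ 1 * x * θ 1
  ι : Type
  [fintype : Fintype ι]
  left : ι → A
  right : ι → A
  sum_eq : ∑ i, left i * θ 1 * right i = 1

namespace FullCorner

attribute [instance] FullCorner.fintype

variable {k : Type u} [Field k] {A B : Type u} [Ring A] [Algebra k A] [Ring B] [Algebra k B]
  (F : FullCorner k A B)

lemma one_mul_θ (b : B) : F.θ 1 * F.θ b = F.θ b := by rw [← map_mul, one_mul]

lemma θ_mul_one (b : B) : F.θ b * F.θ 1 = F.θ b := by rw [← map_mul, mul_one]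

/-- The element of `B` corresponding to `e x e`. -/
noncomputable def compress (x : A) : B := (F.exists_eq x).choose

lemma θ_compress (x : A) : F.θ (F.compress x) = F.θ 1 * x * F.θ 1 := (F.exists_eq x).choose_spec

lemma compress_add (x y : A) : F.compress (x + y) = F.compress x + F.compress y :=
  F.injective (by simp only [map_add, θ_compress, mul_add, add_mul])

lemma compress_zero : F.compress 0 = 0 :=
  F.injective (by simp only [map_zero, θ_compress, mul_zero, zero_mul])

lemma compress_one : F.compress 1 = 1 :=
  F.injective (by rw [θ_compress, mul_one, θ_mul_one])

lemma compress_θ_mul (b : B) (x : A) : F.compress (F.θ b * x) = b * F.compress x :=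
  F.injective (by
    rw [map_mul, θ_compress, θ_compress]
    simp only [← mul_assoc, one_mul_θ, θ_mul_one])

lemma compress_mul_θ (b : B) (x : A) : F.compress (x * F.θ b) = F.compress x * b :=
  F.injective (by
    rw [map_mul, θ_compress, θ_compress]
    simp only [mul_assoc, one_mul_θ, θ_mul_one])

/-- The corner `e M` of an `A`-module `M`. -/
def Corner (M : Type u) [AddCommGroup M] [Module A M] : AddSubgroup M where
  carrier := {m | F.θ 1 • m = m}
  add_mem' {x y} hx hy := by
    simp only [Set.mem_ofPred_eq] at hx hy ⊢
    rw [smul_add, hx, hy]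
  zero_mem' := smul_zero _
  neg_mem' {x} hx := by
    simp only [Set.mem_ofPred_eq] at hx ⊢
    rw [smul_neg, hx]

/-! ### Full faithfulness of `M ↦ e M`. -/

section Module

variable {M N : Type u} [AddCommGroup M] [Module A M] [AddCommGroup N] [Module A N]

lemma one_smul_corner (m : F.Corner M) : F.θ 1 • (m : M) = (m : M) := m.2

lemma θ_smul_mem (b : B) (m : M) : F.θ b • m ∈ F.Corner M := by
  change F.θ 1 • F.θ b • m = F.θ b • m
  rw [smul_smul, one_mul_θ]

noncomputable instance : Module B (F.Corner M) where
  smul b m := ⟨F.θ b • (m : M), F.θ_smul_mem b (m : M)⟩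
  one_smul m := Subtype.ext m.2
  mul_smul b c m := Subtype.ext (by
    change F.θ (b * c) • (m : M) = F.θ b • F.θ c • (m : M)
    rw [map_mul, mul_smul])
  smul_zero b := Subtype.ext (smul_zero (F.θ b) : F.θ b • (0 : M) = 0)
  smul_add b m m' := Subtype.ext (smul_add (F.θ b) (m : M) (m' : M))
  add_smul b c m := Subtype.ext (by
    change F.θ (b + c) • (m : M) = F.θ b • (m : M) + F.θ c • (m : M)
    rw [map_add, add_smul])
  zero_smul m := Subtype.ext (by
    change F.θ 0 • (m : M) = 0
    rw [map_zero, zero_smul])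

lemma coe_smul (b : B) (m : F.Corner M) : ((b • m : F.Corner M) : M) = F.θ b • (m : M) := rfl

/-- The linear map between the corners induced by an `A`-linear map. -/
def cornerMap (f : M →ₗ[A] N) : F.Corner M →ₗ[B] F.Corner N where
  toFun m := ⟨f m, by
    change F.θ 1 • f m = f m
    rw [← map_smul, one_smul_corner]⟩
  map_add' m m' := Subtype.ext (map_add f _ _)
  map_smul' b m := Subtype.ext (map_smul f _ _)

lemma coe_cornerMap (f : M →ₗ[A] N) (m : F.Corner M) : (F.cornerMap f m : N) = f m := rfl

/-- The projection `m ↦ e m` onto the corner. -/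
def proj (m : M) : F.Corner M := ⟨F.θ 1 • m, F.θ_smul_mem 1 m⟩

lemma proj_add (m m' : M) : F.proj (m + m') = F.proj m + F.proj m' :=
  Subtype.ext (smul_add _ _ _)

/-- Fullness `A e A = A` in module form: each element of `M` is rebuilt from components in `e M`. -/
lemma sum_smul_proj (m : M) : ∑ i, F.left i • (F.proj (F.right i • m) : M) = m := by
  simp only [proj, smul_smul, ← Finset.sum_smul, ← mul_assoc, F.sum_eq, one_smul]

lemma proj_smul_coe (x : A) (m : F.Corner M) : F.proj (x • (m : M)) = F.compress x • m :=
  Subtype.ext (by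
    rw [coe_smul, θ_compress, mul_smul, mul_smul, one_smul_corner]
    rfl)

/-- Expresses the action of `A` on the components of `m` through scalars of `B`, so that a
`B`-linear map can be moved past it. -/
lemma proj_eq_sum (x : A) (m : M) :
    F.proj (x • m) = ∑ j, F.compress (x * F.left j) • F.proj (F.right j • m) := by
  conv_lhs => rw [← F.sum_smul_proj m, Finset.smul_sum]
  have : ∀ s : Finset F.ι, F.proj (∑ j ∈ s, x • F.left j • (F.proj (F.right j • m) : M)) =
      ∑ j ∈ s, F.compress (x * F.left j) • F.proj (F.right j • m) := by
    classical
    intro s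
    induction s using Finset.induction_on with
    | empty => exact Subtype.ext (smul_zero _)
    | insert j s hj ih => rw [Finset.sum_insert hj, Finset.sum_insert hj, proj_add, ih, smul_smul,
        proj_smul_coe]
  exact this _

lemma cornerMap_injective : Function.Injective (F.cornerMap : (M →ₗ[A] N) → _) := by
  intro f g h
  ext m
  rw [← F.sum_smul_proj m, map_sum, map_sum]
  refine Finset.sum_congr rfl fun i _ => ?_
  rw [map_smul, map_smul, ← coe_cornerMap, h, coe_cornerMap]

lemma cornerMap_surjective : Function.Surjective (F.cornerMap : (M →ₗ[A] N) → _) := by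
  intro f
  -- The only possible extension of `f`: apply `f` to the components given by `sum_smul_proj` and
  -- reassemble.
  refine ⟨{ toFun := fun m => ∑ i, F.left i • (f (F.proj (F.right i • m)) : N)
            map_add' := fun m m' => ?_
            map_smul' := fun a m => ?_ }, ?_⟩
  · simp only [smul_add, proj_add, map_add, AddSubgroup.coe_add, Finset.sum_add_distrib]
  · simp only [RingHom.id_apply, Finset.smul_sum, smul_smul]
    simp only [F.proj_eq_sum (F.right _ * a) m, map_sum, map_smul, AddSubgroup.val_finsetSum,
      coe_smul, θ_compress, Finset.smul_sum, smul_smul]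
    rw [Finset.sum_comm]
    refine Finset.sum_congr rfl fun j _ => ?_
    rw [← Finset.sum_smul]
    -- The relation `sum_eq` absorbs the sum over `i`; the remaining factor `F.θ 1` acts trivially
    -- because `f` takes values in the corner.
    have : ∑ i, F.left i * (F.θ 1 * (F.right i * a * F.left j) * F.θ 1) =
        a * F.left j * F.θ 1 := by
      simp only [← mul_assoc, ← Finset.sum_mul, F.sum_eq, one_mul]
    rw [this, mul_smul _ (F.θ 1), one_smul_corner]
  · ext m
    change ∑ i, F.left i • (f (F.proj (F.right i • (m : M))) : N) = f m
    simp only [proj_smul_coe, map_smul, coe_smul, θ_compress]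
    simp only [mul_smul, one_smul_corner]
    simp only [smul_smul, ← Finset.sum_smul, ← mul_assoc, F.sum_eq, one_smul]

end Module

/-! ### Essential surjectivity of `M ↦ e M`, by coinduction. -/

section Coinduced

variable (N : Type u) [AddCommGroup N] [Module B N]

/-- The `A`-module `Hom_B(e A, N)`, as a group of additive maps on `A`. -/
def Coinduced : AddSubgroup (A →+ N) where
  carrier := {φ | ∀ (b : B) (x : A), φ (F.θ b * x) = b • φ x}
  add_mem' {φ ψ} hφ hψ b x := by simp [hφ b x, hψ b x]
  zero_mem' b x := by simp
  neg_mem' {φ} hφ b x := by simp [hφ b x]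

variable {N}

lemma coinduced_apply (φ : F.Coinduced N) (b : B) (x : A) : φ.1 (F.θ b * x) = b • φ.1 x :=
  φ.2 b x

noncomputable instance : Module A (F.Coinduced N) where
  smul a φ := ⟨φ.1.comp (AddMonoidHom.mulRight a), fun b x => by
    change φ.1 (F.θ b * x * a) = b • φ.1 (x * a)
    rw [mul_assoc, coinduced_apply]⟩
  one_smul φ := Subtype.ext (AddMonoidHom.ext fun x => congrArg φ.1 (mul_one x))
  mul_smul a a' φ := Subtype.ext (AddMonoidHom.ext fun x => congrArg φ.1 (mul_assoc x a a').symm)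
  smul_zero a := rfl
  smul_add a φ ψ := rfl
  add_smul a a' φ := Subtype.ext (AddMonoidHom.ext fun x =>
    (congrArg φ.1 (mul_add x a a')).trans (map_add φ.1 _ _))
  zero_smul φ := Subtype.ext (AddMonoidHom.ext fun x =>
    (congrArg φ.1 (mul_zero x)).trans (map_zero φ.1))

lemma smul_coinduced_apply (a : A) (φ : F.Coinduced N) (x : A) : (a • φ).1 x = φ.1 (x * a) := rfl

variable (N) in
/-- The corner of the coinduced module of `N` is `N`. -/
noncomputable def cornerCoinduced : F.Corner (F.Coinduced N) ≃ₗ[B] N :=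
  LinearEquiv.ofBijective
    { toFun := fun φ => φ.1.1 1
      map_add' := fun _ _ => rfl
      map_smul' := fun b φ => by
        change φ.1.1 (1 * F.θ b) = b • φ.1.1 1
        rw [one_mul, ← coinduced_apply, mul_one] } (by
    -- Write `e` for `F.θ 1`. Membership in the coinduced module gives `φ (e x) = φ x`, and
    -- membership in its corner gives `φ (x e) = φ x`. So `φ x = φ (e x e)`, and `φ` is determined
    -- by its value at `1`.
    have key : ∀ (φ : F.Corner (F.Coinduced N)) (x : A),
        φ.1.1 x = F.compress x • φ.1.1 1 := by
      intro φ x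
      rw [← coinduced_apply, mul_one, θ_compress, mul_assoc, coinduced_apply, one_smul,
        ← smul_coinduced_apply, one_smul_corner]
    constructor
    · intro φ ψ h
      refine Subtype.ext (Subtype.ext (AddMonoidHom.ext fun x => ?_))
      rw [key φ, key ψ]
      exact congrArg (F.compress x • ·) h
    · intro m
      refine ⟨⟨⟨{ toFun := fun x => F.compress x • m
                  map_zero' := by rw [compress_zero, zero_smul]
                  map_add' := fun x y => by rw [compress_add, add_smul] }, fun b x => ?_⟩, ?_⟩, ?_⟩
      · change F.compress (F.θ b * x) • m = b • F.compress x • m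
        rw [compress_θ_mul, mul_smul]
      · refine Subtype.ext (AddMonoidHom.ext fun x => ?_)
        change F.compress (x * F.θ 1) • m = F.compress x • m
        rw [compress_mul_θ, mul_one]
      · change F.compress 1 • m = m
        rw [compress_one, one_smul])

end Coinduced

/-- The functor `M ↦ e M`. -/
noncomputable def cornerFunctor : ModuleCat.{u} A ⥤ ModuleCat.{u} B where
  obj M := ModuleCat.of B (F.Corner M)
  map f := ModuleCat.ofHom (F.cornerMap f.hom)

instance : F.cornerFunctor.Faithful where
  map_injective h := ModuleCat.hom_ext (F.cornerMap_injective (congrArg ModuleCat.Hom.hom h))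

instance : F.cornerFunctor.Full where
  map_surjective f := by
    obtain ⟨g, hg⟩ := F.cornerMap_surjective f.hom
    exact ⟨ModuleCat.ofHom g, ModuleCat.hom_ext hg⟩

instance : F.cornerFunctor.EssSurj where
  mem_essImage N := ⟨ModuleCat.of A (F.Coinduced N), ⟨(F.cornerCoinduced N).toModuleIso⟩⟩

instance : F.cornerFunctor.IsEquivalence where

open scoped ModuleCat.Algebra in
instance : F.cornerFunctor.Additive where
  map_add := rfl

open scoped ModuleCat.Algebra in
instance : F.cornerFunctor.Linear k where
  map_smul {M N} f c := by
    refine ModuleCat.hom_ext (LinearMap.ext fun (m : F.Corner M) => Subtype.ext ?_)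
    -- Scalars act through the units of `A` and of `B` respectively; `F.θ` sends `c • 1` to `c • F.θ
    -- 1`, which acts as `c` on the corner.
    change algebraMap k A c • f.hom (m : M) = F.θ (algebraMap k B c) • f.hom (m : M)
    rw [Algebra.algebraMap_eq_smul_one c, Algebra.algebraMap_eq_smul_one c, map_smul,
      ← smul_one_mul c (F.θ 1), mul_smul, ← map_smul f.hom (F.θ 1), one_smul_corner]

/-- Morita equivalence of an algebra with a full corner. -/
theorem isMoritaEquivalent (F : FullCorner k A B) : IsMoritaEquivalent k A B :=
  ⟨⟨{ eqv := (cornerFunctor F).asEquivalence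
      linear := inferInstanceAs ((cornerFunctor F).Linear k) }⟩⟩

end FullCorner

/-! ### Category algebras of equivalent categories -/

namespace CategoryAlgebra

variable (k : Type u) [Field k] {S E : Type} [Category.{0} S] [Category.{0} E]

/-- The linear map between category algebras induced by a functor. -/
noncomputable def mapLin (G : S ⥤ E) : CategoryAlgebra k S →ₗ[k] CategoryAlgebra k E :=
  Finsupp.lmapDomain k k fun m : Mor S => (⟨G.obj m.1, G.obj m.2.1, G.map m.2.2⟩ : Mor E)

lemma mapLin_single (G : S ⥤ E) {a b : S} (f : a ⟶ b) :
    mapLin k G (single k f) = single k (G.map f) :=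
  Finsupp.mapDomain_single

lemma mapLin_injective (G : S ⥤ E) [G.Faithful] (hG : Function.Injective G.obj) :
    Function.Injective (mapLin k G) := by
  refine Finsupp.mapDomain_injective ?_
  rintro ⟨a, b, f⟩ ⟨a', b', f'⟩ h
  obtain rfl : a = a' := hG (congrArg (fun m : Mor E => m.1) h)
  obtain rfl : b = b' := hG (congrArg (fun m : Mor E => m.2.1) h)
  have : G.map f = G.map f' := by simpa using h
  rw [G.map_injective this]

/-- Injectivity on objects ensures that morphisms that are not composable stay so, and that zero
products are preserved. -/
lemma mapLin_mul (G : S ⥤ E) (hG : Function.Injective G.obj) (x y : CategoryAlgebra k S) :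
    mapLin k G (x * y) = mapLin k G x * mapLin k G y := by
  induction x using CategoryAlgebra.induction with
  | zero => simp
  | add x y hx hy => simp only [add_mul, map_add, hx, hy]
  | @smul_single b' c g r =>
  induction y using CategoryAlgebra.induction with
  | zero => simp
  | add x y hx hy => simp only [mul_add, map_add, hx, hy]
  | @smul_single a b f s =>
  simp only [smul_mul, mul_smul', map_smul]
  congr 2
  by_cases h : b = b'
  · subst h
    rw [single_mul_single, mapLin_single, mapLin_single, mapLin_single, single_mul_single,
      G.map_comp]
  · rw [single_mul_single_of_ne _ _ h, mapLin_single, mapLin_single,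
      single_mul_single_of_ne _ _ fun e => h (hG e), map_zero]

variable [Fintype S] [Fintype E]

lemma mapLin_one (G : S ⥤ E) : mapLin k G 1 = ∑ s, idem k (G.obj s) := by
  rw [one_def, map_sum]
  refine Finset.sum_congr rfl fun s _ => ?_
  rw [mapLin_single, G.map_id, idem]

variable {k} in
lemma mapLin_one_mul_single (G : S ⥤ E) (hG : Function.Injective G.obj) {a : E} {s : S}
    (f : a ⟶ G.obj s) : mapLin k G 1 * single k f = single k f := by
  rw [mapLin_one, Finset.sum_mul, Finset.sum_eq_single s]
  · rw [idem, single_mul_single, Category.comp_id]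
  · exact fun t _ h => single_mul_single_of_ne _ _ fun e => h (hG e).symm
  · exact fun h => (h (Finset.mem_univ s)).elim

variable {k} in
lemma single_mul_mapLin_one (G : S ⥤ E) (hG : Function.Injective G.obj) {b : E} {s : S}
    (f : G.obj s ⟶ b) : single k f * mapLin k G 1 = single k f := by
  rw [mapLin_one, Finset.mul_sum, Finset.sum_eq_single s]
  · rw [idem, single_mul_single, Category.id_comp]
  · exact fun t _ h => single_mul_single_of_ne _ _ fun e => h (hG e)
  · exact fun h => (h (Finset.mem_univ s)).elim

/-- The idempotent `mapLin k G 1` kills the morphisms with an end outside the image of `G`; the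
others come from `S` by fullness. -/
lemma exists_mapLin_eq (G : S ⥤ E) [G.Full] (hG : Function.Injective G.obj)
    (x : CategoryAlgebra k E) : ∃ y, mapLin k G y = mapLin k G 1 * x * mapLin k G 1 := by
  induction x using CategoryAlgebra.induction with
  | zero => exact ⟨0, by simp⟩
  | add x y hx hy =>
    obtain ⟨x', hx⟩ := hx
    obtain ⟨y', hy⟩ := hy
    exact ⟨x' + y', by rw [map_add, hx, hy, mul_add, add_mul]⟩
  | @smul_single a b f c =>
    by_cases hb : ∃ t, G.obj t = b
    · obtain ⟨t, rfl⟩ := hb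
      rw [mul_smul', mapLin_one_mul_single G hG, smul_mul]
      by_cases ha : ∃ s, G.obj s = a
      · obtain ⟨s, rfl⟩ := ha
        obtain ⟨g, rfl⟩ := G.map_surjective f
        exact ⟨c • single k g, by rw [single_mul_mapLin_one G hG, map_smul, mapLin_single]⟩
      · refine ⟨0, ?_⟩
        rw [mapLin_one, Finset.mul_sum, Finset.sum_eq_zero, smul_zero, map_zero]
        exact fun s _ => single_mul_single_of_ne _ _ fun e => ha ⟨s, e⟩
    · refine ⟨0, ?_⟩
      rw [mul_smul', mapLin_one, Finset.sum_mul, Finset.sum_eq_zero, smul_zero, zero_mul, map_zero]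
      exact fun s _ => single_mul_single_of_ne _ _ fun e => hb ⟨s, e.symm⟩

/-- An equivalence of categories which is injective on objects embeds the category algebra as a
full corner. -/
noncomputable def fullCorner (G : S ⥤ E) [G.Full] [G.Faithful] [G.EssSurj]
    (hG : Function.Injective G.obj) :
    FullCorner k (CategoryAlgebra k E) (CategoryAlgebra k S) where
  θ :=
    { toFun := mapLin k G
      map_smul' := fun c x => map_smul (mapLin k G) c x
      map_zero' := map_zero (mapLin k G)
      map_add' := map_add (mapLin k G)
      map_mul' := mapLin_mul k G hG }
  injective := mapLin_injective k G hG
  exists_eq := exists_mapLin_eq k G hG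
  ι := E
  -- Each identity of `E` factors through an object in the image of `G`, as an isomorphism composed
  -- with its inverse. Summing these factorizations gives `1`.
  left a := single k (G.objObjPreimageIso a).hom
  right a := single k (G.objObjPreimageIso a).inv
  sum_eq := by
    refine Finset.sum_congr rfl fun a _ => ?_
    change single k _ * mapLin k G 1 * single k _ = _
    rw [single_mul_mapLin_one G hG, single_mul_single, Iso.inv_hom_id]

end CategoryAlgebra

/-! ### Order-preserving partial functions -/

namespace PO

variable {n : ℕ}

lemma ext_mem {f g : PO n} (h : ∀ x y, y ∈ f.toPFun x ↔ y ∈ g.toPFun x) : f = g :=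
  PO.ext (PFun.ext h)

lemma mem_mul {f g : PO n} {x z : Fin n} :
    z ∈ (g * f).toPFun x ↔ ∃ y, y ∈ f.toPFun x ∧ z ∈ g.toPFun y :=
  Part.mem_bind_iff

lemma mem_one {x y : Fin n} : y ∈ (1 : PO n).toPFun x ↔ y = x := Part.mem_some_iff

lemma mem_unique {f : PO n} {x y z : Fin n} (hy : y ∈ f.toPFun x) (hz : z ∈ f.toPFun x) : y = z :=
  Part.mem_unique hy hz

instance : Finite (PO n) :=
  Finite.of_injective (fun f : PO n => fun x y => y ∈ f.toPFun x) fun _ _ h =>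
    ext_mem fun x y => Iff.of_eq (congrFun (congrFun h x) y)

/-- The partial function whose graph is a given monotone relation. -/
noncomputable def ofRel (r : Fin n → Fin n → Prop)
    (hr : ∀ x x' y y', x ≤ x' → r x y → r x' y' → y ≤ y') : PO n where
  toPFun x := ⟨∃ y, r x y, fun h => h.choose⟩
  monotone := by
    rintro x x' _ _ hx ⟨h, rfl⟩ ⟨h', rfl⟩
    exact hr _ _ _ _ hx h.choose_spec h'.choose_spec

lemma mem_ofRel {r : Fin n → Fin n → Prop}
    {hr : ∀ x x' y y', x ≤ x' → r x y → r x' y' → y ≤ y'} {x y : Fin n} :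
    y ∈ (ofRel r hr).toPFun x ↔ r x y := by
  constructor
  · rintro ⟨h, rfl⟩
    exact h.choose_spec
  · intro h
    exact ⟨⟨y, h⟩, le_antisymm (hr _ _ _ _ le_rfl (Exists.choose_spec ⟨y, h⟩) h)
      (hr _ _ _ _ le_rfl h (Exists.choose_spec ⟨y, h⟩))⟩

/-- The partial identity on a subset. -/
noncomputable def idOn (T : Finset (Fin n)) : PO n :=
  ofRel (fun x y => x ∈ T ∧ y = x) fun _ _ _ _ h h₁ h₂ => by rwa [h₁.2, h₂.2]

lemma mem_idOn {T : Finset (Fin n)} {x y : Fin n} :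
    y ∈ (idOn T).toPFun x ↔ x ∈ T ∧ y = x := mem_ofRel

open Classical in
/-- The domain of a partial function. -/
noncomputable def dom (f : PO n) : Finset (Fin n) := {x | ∃ y, y ∈ f.toPFun x}

open Classical in
/-- The range of a partial function. -/
noncomputable def ran (f : PO n) : Finset (Fin n) := {y | ∃ x, y ∈ f.toPFun x}

lemma mem_dom {f : PO n} {x : Fin n} : x ∈ f.dom ↔ ∃ y, y ∈ f.toPFun x := by simp [dom]

lemma mem_ran {f : PO n} {y : Fin n} : y ∈ f.ran ↔ ∃ x, y ∈ f.toPFun x := by simp [ran]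

lemma mem_mul_idOn {f : PO n} {T : Finset (Fin n)} {x y : Fin n} :
    y ∈ (f * idOn T).toPFun x ↔ x ∈ T ∧ y ∈ f.toPFun x := by
  rw [mem_mul]
  simp only [mem_idOn]
  constructor
  · rintro ⟨_, ⟨h, rfl⟩, h'⟩
    exact ⟨h, h'⟩
  · rintro ⟨h, h'⟩
    exact ⟨_, ⟨h, rfl⟩, h'⟩

lemma dom_mul_idOn {f : PO n} {T : Finset (Fin n)} (h : T ⊆ f.dom) : (f * idOn T).dom = T := by
  ext x
  simp only [mem_dom, mem_mul_idOn]
  constructor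
  · rintro ⟨y, hx, -⟩
    exact hx
  · intro hx
    obtain ⟨y, hy⟩ := mem_dom.1 (h hx)
    exact ⟨y, hx, hy⟩

lemma mul_idOn_dom (f : PO n) : f * idOn f.dom = f :=
  ext_mem fun x y => by
    rw [mem_mul_idOn]
    exact ⟨fun h => h.2, fun h => ⟨mem_dom.2 ⟨y, h⟩, h⟩⟩

lemma idOn_ran_mul (f : PO n) : idOn f.ran * f = f :=
  ext_mem fun x y => by
    rw [mem_mul]
    simp only [mem_idOn]
    constructor
    · rintro ⟨_, h, -, rfl⟩
      exact h
    · exact fun h => ⟨y, h, mem_ran.2 ⟨x, h⟩, rfl⟩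

lemma dom_idOn (T : Finset (Fin n)) : (idOn T).dom = T := by
  ext x
  simp [mem_dom, mem_idOn]

lemma ran_idOn (T : Finset (Fin n)) : (idOn T).ran = T := by
  ext x
  simp [mem_ran, mem_idOn]

lemma dom_mul {f g : PO n} (h : f.ran = g.dom) : (g * f).dom = f.dom := by
  ext x
  simp only [mem_dom, mem_mul]
  constructor
  · rintro ⟨_, y, hy, -⟩
    exact ⟨y, hy⟩
  · rintro ⟨y, hy⟩
    obtain ⟨z, hz⟩ := mem_dom.1 (h ▸ mem_ran.2 ⟨x, hy⟩)
    exact ⟨z, y, hy, hz⟩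

lemma ran_mul {f g : PO n} (h : f.ran = g.dom) : (g * f).ran = g.ran := by
  ext z
  simp only [mem_ran, mem_mul]
  constructor
  · rintro ⟨_, y, -, hz⟩
    exact ⟨y, hz⟩
  · rintro ⟨y, hz⟩
    obtain ⟨x, hx⟩ := mem_ran.1 (h ▸ mem_dom.2 ⟨z, hz⟩ : y ∈ f.ran)
    exact ⟨x, y, hx, hz⟩

/-- This matches the restrictions of `g * f` with the pairs of composable restrictions of `f` and
`g`. -/
lemma subset_dom_mul_iff {f g : PO n} {T : Finset (Fin n)} :
    T ⊆ (g * f).dom ↔ T ⊆ f.dom ∧ (f * idOn T).ran ⊆ g.dom := by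
  constructor
  · intro h
    constructor
    · intro x hx
      obtain ⟨z, hz⟩ := mem_dom.1 (h hx)
      obtain ⟨y, hy, -⟩ := mem_mul.1 hz
      exact mem_dom.2 ⟨y, hy⟩
    · intro y hy
      obtain ⟨x, hx⟩ := mem_ran.1 hy
      obtain ⟨hT, hx⟩ := mem_mul_idOn.1 hx
      obtain ⟨z, hz⟩ := mem_dom.1 (h hT)
      obtain ⟨y', hy', hz⟩ := mem_mul.1 hz
      obtain rfl := mem_unique hx hy'
      exact mem_dom.2 ⟨z, hz⟩
  · rintro ⟨h₁, h₂⟩ x hx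
    obtain ⟨y, hy⟩ := mem_dom.1 (h₁ hx)
    obtain ⟨z, hz⟩ := mem_dom.1 (h₂ (mem_ran.2 ⟨x, mem_mul_idOn.2 ⟨hx, hy⟩⟩))
    exact mem_dom.2 ⟨z, mem_mul.2 ⟨y, hy, hz⟩⟩

end PO

/-- The objects of the category of order-preserving surjections between subsets of a chain. -/
@[ext]
structure SubChain (n : ℕ) where
  set : Finset (Fin n)

namespace SubChain

variable {n : ℕ}

/-- The objects correspond to the subsets. -/
def equivFinset (n : ℕ) : SubChain n ≃ Finset (Fin n) where
  toFun := SubChain.set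
  invFun := SubChain.mk

instance : Fintype (SubChain n) := Fintype.ofEquiv _ (equivFinset n).symm

/-- The category of order-preserving surjections between subsets of a chain; the surjections are
viewed as partial functions on the chain. -/
noncomputable instance : Category (SubChain n) where
  Hom a b := {f : PO n // f.dom = a.set ∧ f.ran = b.set}
  id a := ⟨PO.idOn a.set, PO.dom_idOn _, PO.ran_idOn _⟩
  comp f g := ⟨g.1 * f.1, (PO.dom_mul (f.2.2.trans g.2.1.symm)).trans f.2.1,
    (PO.ran_mul (f.2.2.trans g.2.1.symm)).trans g.2.2⟩
  id_comp f := Subtype.ext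
    ((congrArg (f.1 * PO.idOn ·) f.2.1.symm).trans (PO.mul_idOn_dom f.1))
  comp_id f := Subtype.ext
    ((congrArg (PO.idOn · * f.1) f.2.2.symm).trans (PO.idOn_ran_mul f.1))
  assoc f g h := Subtype.ext (mul_assoc h.1 g.1 f.1).symm

/-- An order-preserving partial function as a morphism from its domain to its range. -/
noncomputable def ofPO (f : PO n) : (⟨f.dom⟩ : SubChain n) ⟶ ⟨f.ran⟩ := ⟨f, rfl, rfl⟩

/-- The morphisms are the order-preserving partial functions. -/
noncomputable def morEquiv (n : ℕ) : Mor (SubChain n) ≃ PO n where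
  toFun m := m.2.2.1
  invFun f := ⟨_, _, ofPO f⟩
  left_inv := by
    rintro ⟨⟨a⟩, ⟨b⟩, f, h₁, h₂⟩
    simp only at h₁ h₂
    subst h₁ h₂
    rfl
  right_inv _ := rfl

end SubChain

/-! ### The algebra of the monoid of order-preserving partial functions -/

namespace SubChain

open CategoryAlgebra PO

variable (k : Type u) [Field k] {n : ℕ}

/-- An order-preserving partial function as a basis element of the category algebra. -/
noncomputable def basisElt (f : PO n) : CategoryAlgebra k (SubChain n) := single k (ofPO f)

lemma single_eq_basisElt {a b : SubChain n} (f : a ⟶ b) : single k f = basisElt k f.1 := by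
  obtain ⟨a⟩ := a
  obtain ⟨b⟩ := b
  obtain ⟨f, h₁, h₂⟩ := f
  simp only at h₁ h₂
  subst h₁ h₂
  rfl

lemma idem_eq_basisElt (a : SubChain n) : CategoryAlgebra.idem k a = basisElt k (idOn a.set) :=
  single_eq_basisElt k (𝟙 a)

lemma basisElt_mul_of_eq {f g : PO n} (h : f.ran = g.dom) :
    basisElt k g * basisElt k f = basisElt k (g * f) := by
  let f' : (⟨f.dom⟩ : SubChain n) ⟶ ⟨g.dom⟩ := ⟨f, rfl, h⟩
  have hf : basisElt k f = single k f' := (single_eq_basisElt k f').symm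
  rw [hf, basisElt, single_mul_single, single_eq_basisElt]
  rfl

lemma basisElt_mul_of_ne {f g : PO n} (h : f.ran ≠ g.dom) :
    basisElt k g * basisElt k f = 0 :=
  single_mul_single_of_ne _ _ fun e => h (congrArg SubChain.set e)

/-- The sum of all restrictions of a partial function. -/
noncomputable def sumRestrict (f : PO n) : CategoryAlgebra k (SubChain n) :=
  ∑ T ∈ f.dom.powerset, basisElt k (f * idOn T)

lemma sumRestrict_one : sumRestrict k (1 : PO n) = 1 := by
  classical
  have h : (1 : PO n).dom = Finset.univ := by
    ext x
    simp [mem_dom, mem_one]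
  rw [sumRestrict, h, Finset.powerset_univ, one_def]
  refine (Fintype.sum_equiv (equivFinset n) _ _ fun a => ?_).symm
  rw [one_mul]
  exact idem_eq_basisElt k a

/-- A restriction of `g` to `S` composes with the restriction of `f` to `T` only when `S` is the
image of `T`. So each `T` contributes at most one term, and does so when its image lies in the
domain of `g`. -/
lemma sumRestrict_mul (g f : PO n) :
    sumRestrict k (g * f) = sumRestrict k g * sumRestrict k f := by
  classical
  have key : ∀ T ∈ f.dom.powerset, sumRestrict k g * basisElt k (f * idOn T) =
      if (f * idOn T).ran ⊆ g.dom then basisElt k (g * f * idOn T) else 0 := by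
    intro T hT
    rw [sumRestrict, Finset.sum_mul]
    split_ifs with h
    · rw [Finset.sum_eq_single (f * idOn T).ran]
      · rw [basisElt_mul_of_eq k (dom_mul_idOn h).symm, mul_assoc, idOn_ran_mul, mul_assoc]
      · intro S hS hne
        refine basisElt_mul_of_ne k ?_
        rw [dom_mul_idOn (Finset.mem_powerset.1 hS)]
        exact hne.symm
      · exact fun h' => (h' (Finset.mem_powerset.2 h)).elim
    · refine Finset.sum_eq_zero fun S hS => basisElt_mul_of_ne k ?_
      rw [dom_mul_idOn (Finset.mem_powerset.1 hS)]
      rintro rfl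
      exact h (Finset.mem_powerset.1 hS)
  rw [sumRestrict.eq_1 k f, Finset.mul_sum, Finset.sum_congr rfl key, ← Finset.sum_filter,
    sumRestrict]
  refine Finset.sum_congr ?_ fun _ _ => rfl
  ext T
  rw [Finset.mem_filter, Finset.mem_powerset, Finset.mem_powerset, subset_dom_mul_iff]

variable (n) in
/-- The homomorphism from the monoid algebra to the category algebra which sends a partial function
to the sum of its restrictions. -/
noncomputable def restrictHom :
    MonoidAlgebra k (PO n) →ₐ[k] CategoryAlgebra k (SubChain n) :=
  MonoidAlgebra.lift k _ (PO n)
    { toFun := sumRestrict k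
      map_one' := sumRestrict_one k
      map_mul' := sumRestrict_mul k }

lemma restrictHom_single (f : PO n) :
    restrictHom k n (MonoidAlgebra.single f 1) = sumRestrict k f :=
  (MonoidAlgebra.lift_single _ _ _).trans (one_smul k _)

/-- Möbius inversion as an induction on the size of the domain: `sumRestrict k f` is `basisElt k f`
plus terms for the proper restrictions of `f`. -/
lemma basisElt_mem_range (f : PO n) :
    basisElt k f ∈ LinearMap.range (restrictHom k n).toLinearMap := by
  induction h : f.dom.card using Nat.strong_induction_on generalizing f with
  | _ m ih =>
    subst h
    have h : basisElt k f = sumRestrict k f - ∑ T ∈ f.dom.ssubsets, basisElt k (f * idOn T) := by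
      rw [eq_sub_iff_add_eq, sumRestrict, Finset.ssubsets,
        ← Finset.add_sum_erase _ _ (Finset.mem_powerset_self f.dom), mul_idOn_dom]
    rw [h]
    refine sub_mem ⟨_, restrictHom_single k f⟩ (sum_mem fun T hT => ?_)
    have hT := Finset.mem_ssubsets.1 hT
    exact ih _ (by rw [dom_mul_idOn hT.subset]; exact Finset.card_lt_card hT) _ rfl

lemma restrictHom_surjective : Function.Surjective (restrictHom k n) := by
  intro x
  change x ∈ LinearMap.range (restrictHom k n).toLinearMap
  induction x using CategoryAlgebra.induction with
  | zero => exact zero_mem _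
  | add x y hx hy => exact add_mem hx hy
  | smul_single f c =>
    rw [single_eq_basisElt]
    exact Submodule.smul_mem _ _ (basisElt_mem_range k _)

/-- The monoid algebra and the category algebra have the same dimension. -/
noncomputable def linearEquiv : MonoidAlgebra k (PO n) ≃ₗ[k] CategoryAlgebra k (SubChain n) :=
  (MonoidAlgebra.coeffLinearEquiv k).trans (Finsupp.domLCongr (morEquiv n).symm)

/-- Both algebras have a basis indexed by `PO n`, so their finite dimensions agree and surjectivity
is enough. -/
lemma restrictHom_bijective : Function.Bijective (restrictHom k n) := by
  have : FiniteDimensional k (MonoidAlgebra k (PO n)) :=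
    Module.Finite.equiv (MonoidAlgebra.coeffLinearEquiv k).symm
  have : FiniteDimensional k (CategoryAlgebra k (SubChain n)) :=
    Module.Finite.equiv (linearEquiv k)
  exact ⟨(LinearMap.injective_iff_surjective_of_finrank_eq_finrank (linearEquiv k).finrank_eq
    (f := (restrictHom k n).toLinearMap)).2 (restrictHom_surjective k), restrictHom_surjective k⟩

end SubChain

/-! ### The skeleton of the category of subsets -/

namespace PO

variable {n : ℕ}

/-- An order-preserving map between two chains embedded into `[n]`, as a partial function. -/
noncomputable def push {a b : ℕ} (α : Fin a ↪o Fin n) (β : Fin b ↪o Fin n) (f : Fin a →o Fin b) :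
    PO n :=
  ofRel (fun x y => ∃ i, α i = x ∧ β (f i) = y) (by
    rintro _ _ _ _ h ⟨i, rfl, rfl⟩ ⟨j, rfl, rfl⟩
    exact β.monotone (f.monotone (α.le_iff_le.1 h)))

lemma mem_push {a b : ℕ} {α : Fin a ↪o Fin n} {β : Fin b ↪o Fin n} {f : Fin a →o Fin b}
    {x y : Fin n} : y ∈ (push α β f).toPFun x ↔ ∃ i, α i = x ∧ β (f i) = y := mem_ofRel

/-- The image of a chain embedded into `[n]`. -/
def image {a : ℕ} (α : Fin a ↪o Fin n) : Finset (Fin n) := Finset.univ.map α.toEmbedding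

lemma mem_image {a : ℕ} {α : Fin a ↪o Fin n} {x : Fin n} : x ∈ image α ↔ ∃ i, α i = x := by
  simp [image]

lemma dom_push {a b : ℕ} (α : Fin a ↪o Fin n) (β : Fin b ↪o Fin n) (f : Fin a →o Fin b) :
    (push α β f).dom = image α := by
  ext x
  simp only [mem_dom, mem_push, mem_image]
  exact ⟨fun ⟨_, i, h, _⟩ => ⟨i, h⟩, fun ⟨i, h⟩ => ⟨_, i, h, rfl⟩⟩

lemma ran_push {a b : ℕ} (α : Fin a ↪o Fin n) (β : Fin b ↪o Fin n) (f : Fin a →o Fin b)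
    (hf : Function.Surjective f) : (push α β f).ran = image β := by
  ext y
  simp only [mem_ran, mem_push, mem_image]
  constructor
  · rintro ⟨_, i, _, h⟩
    exact ⟨_, h⟩
  · rintro ⟨j, h⟩
    obtain ⟨i, rfl⟩ := hf j
    exact ⟨_, i, rfl, h⟩

lemma push_mul_push {a b c : ℕ} (α : Fin a ↪o Fin n) (β : Fin b ↪o Fin n) (γ : Fin c ↪o Fin n)
    (f : Fin a →o Fin b) (g : Fin b →o Fin c) :
    push β γ g * push α β f = push α γ (g.comp f) :=
  ext_mem fun x z => by
    simp only [mem_mul, mem_push]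
    constructor
    · rintro ⟨_, ⟨i, rfl, rfl⟩, j, h, rfl⟩
      obtain rfl := β.injective h
      exact ⟨i, rfl, rfl⟩
    · rintro ⟨i, rfl, rfl⟩
      exact ⟨_, ⟨i, rfl, rfl⟩, _, rfl, rfl⟩

lemma push_id {a : ℕ} (α : Fin a ↪o Fin n) : push α α OrderHom.id = idOn (image α) :=
  ext_mem fun x y => by
    simp only [mem_push, mem_idOn, mem_image]
    constructor
    · rintro ⟨i, rfl, rfl⟩
      exact ⟨⟨i, rfl⟩, rfl⟩
    · rintro ⟨⟨i, rfl⟩, rfl⟩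
      exact ⟨i, rfl, rfl⟩

lemma exists_push_eq {a b : ℕ} (α : Fin a ↪o Fin n) (β : Fin b ↪o Fin n) (f : PO n)
    (hd : f.dom = image α) (hr : f.ran = image β) :
    ∃ g : Fin a →o Fin b, Function.Surjective g ∧ push α β g = f := by
  have h : ∀ i, ∃ j, β j ∈ f.toPFun (α i) := by
    intro i
    obtain ⟨y, hy⟩ := mem_dom.1 (hd ▸ mem_image.2 ⟨i, rfl⟩ : α i ∈ f.dom)
    obtain ⟨j, rfl⟩ := mem_image.1 (hr ▸ mem_ran.2 ⟨_, hy⟩ : y ∈ image β)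
    exact ⟨j, hy⟩
  choose g hg using h
  refine ⟨⟨g, fun i i' hi => β.le_iff_le.1
    (f.monotone _ _ _ _ (α.monotone hi) (hg i) (hg i'))⟩, fun j => ?_, ext_mem fun x y => ?_⟩
  · obtain ⟨x, hx⟩ := mem_ran.1 (hr ▸ mem_image.2 ⟨j, rfl⟩ : β j ∈ f.ran)
    obtain ⟨i, rfl⟩ := mem_image.1 (hd ▸ mem_dom.2 ⟨_, hx⟩ : x ∈ image α)
    exact ⟨i, β.injective (mem_unique (hg i) hx)⟩
  · rw [mem_push]
    constructor
    · rintro ⟨i, rfl, rfl⟩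
      exact hg i
    · intro hy
      obtain ⟨i, rfl⟩ := mem_image.1 (hd ▸ mem_dom.2 ⟨_, hy⟩ : x ∈ image α)
      exact ⟨i, rfl, mem_unique (hg i) hy⟩

lemma push_injective {a b : ℕ} (α : Fin a ↪o Fin n) (β : Fin b ↪o Fin n) :
    Function.Injective (push α β) := by
  intro f g h
  refine OrderHom.ext _ _ (funext fun i => ?_)
  have : β (f i) ∈ (push α β g).toPFun (α i) := h ▸ mem_push.2 ⟨i, rfl, rfl⟩
  obtain ⟨j, hj, e⟩ := mem_push.1 this
  obtain rfl := α.injective hj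
  exact (β.injective e).symm

end PO

namespace SEO

open PO

variable {n : ℕ}

/-- The initial segment of the chain with a given number of elements. -/
def initial (a : SEO n) : Fin a.card ↪o Fin n := Fin.castLEOrderEmb a.card_le

variable (n) in
/-- The embedding of `SEO_n` into the category of subsets, as the full subcategory of initial
segments. -/
noncomputable def toSubChain : SEO n ⥤ SubChain n where
  obj a := ⟨image a.initial⟩
  map {a b} f := ⟨push a.initial b.initial f.1, dom_push _ _ _, ran_push _ _ _ f.2⟩
  map_id _ := Subtype.ext (push_id _)
  map_comp _ _ := Subtype.ext (push_mul_push _ _ _ _ _).symm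

lemma toSubChain_obj_injective : Function.Injective (toSubChain n).obj := by
  intro a b h
  have := congrArg (fun s : SubChain n => s.set.card) h
  simp only [toSubChain, image, Finset.card_map, Finset.card_univ, Fintype.card_fin] at this
  exact SEO.ext this

instance : (toSubChain n).Faithful where
  map_injective h := Subtype.ext (push_injective _ _ (congrArg Subtype.val h))

instance : (toSubChain n).Full where
  map_surjective f := by
    obtain ⟨g, hg, h⟩ := exists_push_eq _ _ f.1 f.2.1 f.2.2
    exact ⟨⟨g, hg⟩, Subtype.ext h⟩

instance : (toSubChain n).EssSurj where
  mem_essImage T := by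
    let a : SEO n := ⟨T.set.card, (Finset.card_le_univ _).trans_eq (Fintype.card_fin n)⟩
    -- The increasing enumeration of the subset gives an isomorphism with the initial segment of the
    -- same size.
    let α : Fin a.card ↪o Fin n := T.set.orderEmbOfFin rfl
    have hα : image α = T.set := by
      ext x
      rw [mem_image]
      exact Set.ext_iff.1 (Finset.range_orderEmbOfFin T.set rfl) x
    exact ⟨a, ⟨{
      hom := ⟨push a.initial α OrderHom.id, dom_push _ _ _,
        (ran_push _ _ _ Function.surjective_id).trans hα⟩
      inv := ⟨push α a.initial OrderHom.id, (dom_push _ _ _).trans hα,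
        ran_push _ _ _ Function.surjective_id⟩
      hom_inv_id := Subtype.ext ((push_mul_push _ _ _ _ _).trans (push_id _))
      inv_hom_id := Subtype.ext ((push_mul_push _ _ _ _ _).trans
        ((push_id _).trans (congrArg idOn hα))) }⟩⟩

end SEO

/-! ### Assembly of the main theorem. -/

theorem isMoritaEquivalent_PO_SEO (k : Type u) [Field k] (n : ℕ) :
    IsMoritaEquivalent k (MonoidAlgebra k (PO n)) (CategoryAlgebra k (SEO n)) :=
  (IsMoritaEquivalent.of_algEquiv k
    (AlgEquiv.ofBijective (SubChain.restrictHom k n) (SubChain.restrictHom_bijective k))).trans k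
    (CategoryAlgebra.fullCorner k (SEO.toSubChain n)
      SEO.toSubChain_obj_injective).isMoritaEquivalent

theorem isQuiverPresentationBy_SEO (k : Type u) [Field k] (n : ℕ) :
    IsQuiverPresentationBy (FaceQuiver.idem k) (FaceQuiver.arrow k n) (FaceQuiver.faceRel k n) :=
  ⟨FaceQuiver.isOrdinaryQuiver k, FaceQuiver.isLinPresentation k _⟩

theorem mainTheorem3 (k : Type u) [Field k] (n : ℕ) :
    IsQuiverPresentationBy (FaceQuiver.idem k) (FaceQuiver.arrow k n) (FaceQuiver.faceRel k n) ∧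
      IsMoritaEquivalent k (MonoidAlgebra k (PO n)) (CategoryAlgebra k (SEO n)) ∧
      IsQuiverPresentation k (MonoidAlgebra k (PO n)) (FaceQuiver n) (FaceQuiver.faceRel k n) :=
  ⟨isQuiverPresentationBy_SEO k n, isMoritaEquivalent_PO_SEO k n,
    _, _, _, isMoritaEquivalent_PO_SEO k n, _, _, isQuiverPresentationBy_SEO k n⟩
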